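/- Let $\mathfrak H$ be a complex Hilbert space with inner product $(\cdot,\cdot)$, linear in the first entry. A linear relation $H$ in $\mathfrak H$ is a linear subspace of $\mathfrak H\times\mathfrak H$; $\operatorname{dom}H=\{h:\{h,h'\}\in H\text{ for some }h'\}$, $\ker H=\{h:\{h,0\}\in H\}$ and $\operatorname{mul}H=\{h':\{0,h'\}\in H\}$. The relation $H$ is called sectorial (with vertex at the origin) if for some $\alpha\in[0,\pi/2)$ $$\operatorname{Re}(h',h)\ge 0,\qquad |\operatorname{Im}(h',h)|\le(\tan\alpha)\operatorname{Re}(h',h),\qquad \{h,h'\}\in H;$$ the smallest such $\alpha$ is called the semi-angle of $H$. A sectorial relation is maximal sectorial if it has no proper sectorial extension. A form $\mathfrak t$ in $\mathfrak H$ (linear in the first, antilinear in the second entry, defined on a subspace $\operatorname{dom}\mathfrak t$) has the real part $\mathfrak t_{\rm r}=(\mathfrak t+\mathfrak t^*)/2$ and the imaginary part $\mathfrak t_{\rm i}=(\mathfrak t-\mathfrak t^*)/(2i)$, where $\mathfrak t^*[h,k]=\overline{\mathfrak t[k,h]}$. It is sectorial if for some $\alpha\in[0,\pi/2)$ one has $\mathfrak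 t_{\rm r}[h,h]\ge0$ and $|\mathfrak t_{\rm i}[h,h]|\le(\tan\alpha)\,\mathfrak t_{\rm r}[h,h]$ for all $h\in\operatorname{dom}\mathfrak t$. A sectorial form is closed if $h_n\in\operatorname{dom}\mathfrak t$, $h_n\to h$ and $\mathfrak t[h_n-h_m,h_n-h_m]\to0$ imply $h\in\operatorname{dom}\mathfrak t$ and $\mathfrak t[h_n-h,h_n-h]\to0$. **Theorem (second representation theorem).** Let $H$ be a maximal sectorial relation in $\mathfrak H$ with semi-angle $\alpha$. Let $\mathfrak t_H$ be the closed sectorial form corresponding to $H$, that is, $\operatorname{dom}H\subset\operatorname{dom}\mathfrak t_H$ and $\mathfrak t_H[h,k]=(h',k)$ for all $\{h,h'\}\in H$, $k\in\operatorname{dom}\mathfrak t_H$. Let $H_{\rm r}$ be the real part of $H$, that is, the nonnegative selfadjoint relation in $\mathfrak H$ with $\operatorname{dom}H_{\rm r}\subset\operatorname{dom}\mathfrak t_H$ and $(\mathfrak t_H)_{\rm r}[h,k]=(h',k)$ for all $\{h,h'\}\in H_{\rm r}$, $k\in\operatorname{dom}\mathfrak t_H$. Let $(H_{\rm r})_{\rm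 s}=\{\{h,h'\}\in H_{\rm r}:h'\perp\operatorname{mul}H_{\rm r}\}$ be its orthogonal operator part, a nonnegative selfadjoint operator in the Hilbert space $\mathfrak K=\mathfrak H\ominus\operatorname{mul}H_{\rm r}$, and let $S=((H_{\rm r})_{\rm s})^{1/2}$ be its nonnegative selfadjoint square root in $\mathfrak K$. These objects $\mathfrak t_H$, $H_{\rm r}$ and $S$ exist, and there is a bounded selfadjoint operator $G$ on $\mathfrak H$ with $\|G\|=\tan\alpha$ which vanishes on $\ker H_{\rm r}\oplus\operatorname{mul}H_{\rm r}$, such that $\operatorname{dom}\mathfrak t_H=\operatorname{dom}S$ and $$\mathfrak t_H[h,k]=((I+iG)Sh,Sk),\qquad h,k\in\operatorname{dom}\mathfrak t_H .$$ Moreover $$H=S^{\times}(I+iG)S,\qquad \operatorname{mul}H=\operatorname{mul}H_{\rm r},$$ where $S^\times=\{\{k,h'\}\in\mathfrak K\times\mathfrak H:(h',f)=(k,Sf)\text{ for all }f\in\operatorname{dom}S\}$ is the adjoint of $S$ regarded as an operator from $\mathfrak H$ to $\mathfrak K$. -/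

import Mathlib

open scoped ComplexConjugate

noncomputable section

/-! Linear relations from `E` to `F` are subspaces of `E × F`.  The inner product `(x, y)`, linear in
the first entry, is `inner ℂ y x` in Mathlib's convention. -/

namespace LinRel

section Algebra

variable {E F M : Type*} [AddCommGroup E] [Module ℂ E] [AddCommGroup F] [Module ℂ F]
  [AddCommGroup M] [Module ℂ M]

/-- The domain of a linear relation. -/
def dom (T : Submodule ℂ (E × F)) : Submodule ℂ E := T.map (LinearMap.fst ℂ E F)

/-- The kernel `{h | (h, 0) ∈ T}`. -/
def ker (T : Submodule ℂ (E × F)) : Submodule ℂ E := T.comap (LinearMap.inl ℂ E F)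

/-- The multivalued part `{h' | (0, h') ∈ T}`. -/
def mul (T : Submodule ℂ (E × F)) : Submodule ℂ F := T.comap (LinearMap.inr ℂ E F)

/-- The product `R T` of linear relations (first `T`, then `R`). -/
def comp (R : Submodule ℂ (F × M)) (T : Submodule ℂ (E × F)) : Submodule ℂ (E × M) where
  carrier := {p | ∃ f : F, (p.1, f) ∈ T ∧ (f, p.2) ∈ R}
  zero_mem' := ⟨0, T.zero_mem, R.zero_mem⟩
  add_mem' := by
    rintro p q ⟨f, hf, hf'⟩ ⟨g, hg, hg'⟩
    exact ⟨f + g, T.add_mem hf hg, R.add_mem hf' hg'⟩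
  smul_mem' := by
    rintro c p ⟨f, hf, hf'⟩
    exact ⟨c • f, T.smul_mem c hf, R.smul_mem c hf'⟩

end Algebra

section Hilbert

variable {E F : Type*} [NormedAddCommGroup E] [InnerProductSpace ℂ E]
  [NormedAddCommGroup F] [InnerProductSpace ℂ F]

/-- The adjoint of `T ⊆ K × L`, regarded as a linear relation from the closed subspace `K` of `E`
to the closed subspace `L` of `F`:  all `(h, h') ∈ L × K` with `(h', f) = (h, f')` for every
`(f, f') ∈ T`.  It is a linear relation from `L` to `K`, written as a subspace of `F × E`. -/
def adjointIn (K : Submodule ℂ E) (L : Submodule ℂ F) (T : Submodule ℂ (E × F)) :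
    Submodule ℂ (F × E) :=
  T.adjoint ⊓ L.prod K

/-- The orthogonal operator part of a closed linear relation `T`:  the part of `T` with values
orthogonal to `mul T` (the orthogonal complement of `{0} × mul T` in `T`). -/
def opPart (T : Submodule ℂ (E × F)) : Submodule ℂ (E × F) :=
  T ⊓ (⊤ : Submodule ℂ E).prod (mul T)ᗮ

/-- `A` is a nonnegative selfadjoint relation in the Hilbert space `K`, a closed subspace of `E`. -/
def IsNonnegSelfAdjointIn (K : Submodule ℂ E) (A : Submodule ℂ (E × E)) : Prop :=
  adjointIn K K A = A ∧ ∀ p ∈ A, 0 ≤ (inner ℂ p.1 p.2).re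

/-- `S` is the nonnegative selfadjoint square root of `A` in the Hilbert space `K`, a closed
subspace of `E`. -/
def IsSqrtIn (K : Submodule ℂ E) (S A : Submodule ℂ (E × E)) : Prop :=
  IsNonnegSelfAdjointIn K S ∧ comp S S = A

/-- `H` is sectorial with vertex at the origin and semi-angle `α ∈ [0, π / 2)`. -/
def IsSectorialWith (H : Submodule ℂ (E × E)) (α : ℝ) : Prop :=
  0 ≤ α ∧ α < Real.pi / 2 ∧
    ∀ p ∈ H, 0 ≤ (inner ℂ p.1 p.2).re ∧
      |(inner ℂ p.1 p.2).im| ≤ Real.tan α * (inner ℂ p.1 p.2).re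

/-- `H` is sectorial, for some semi-angle in `[0, π / 2)`. -/
def IsSectorial (H : Submodule ℂ (E × E)) : Prop := ∃ α : ℝ, IsSectorialWith H α

/-- `H` is maximal sectorial: it is sectorial and has no proper sectorial extension. -/
def IsMaximalSectorial (H : Submodule ℂ (E × E)) : Prop :=
  IsSectorial H ∧ ∀ H' : Submodule ℂ (E × E), IsSectorial H' → H ≤ H' → H' = H

/-- The semi-angle of a sectorial relation: the smallest admissible one. -/
def semiAngle (H : Submodule ℂ (E × E)) : ℝ := sInf {α : ℝ | IsSectorialWith H α}

/-- The infimum in the definition of the semi-angle is attained. -/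
theorem isLeast_semiAngle {H : Submodule ℂ (E × E)} (hH : IsSectorial H) :
    IsLeast {α : ℝ | IsSectorialWith H α} (semiAngle H) := by
  have hbdd : BddBelow {α : ℝ | IsSectorialWith H α} := ⟨0, fun _ h => h.1⟩
  refine ⟨?_, fun _ h => csInf_le hbdd h⟩
  have h0 : 0 ≤ semiAngle H := le_csInf hH fun _ h => h.1
  obtain ⟨β, hβ⟩ := hH
  have hlt : semiAngle H < Real.pi / 2 := lt_of_le_of_lt (csInf_le hbdd hβ) hβ.2.1
  refine ⟨h0, hlt, fun p hp => ⟨(hβ.2.2 p hp).1, ?_⟩⟩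
  rcases (hβ.2.2 p hp).1.eq_or_lt with hre | hre
  · have := (hβ.2.2 p hp).2
    rw [← hre] at this ⊢
    simpa using this
  · rw [← div_le_iff₀ hre, ← Real.tan_arctan (|(inner ℂ p.1 p.2).im| / (inner ℂ p.1 p.2).re)]
    have hle : Real.arctan (|(inner ℂ p.1 p.2).im| / (inner ℂ p.1 p.2).re) ≤ semiAngle H := by
      refine le_csInf ⟨β, hβ⟩ fun γ hγ => ?_
      have h1 := (div_le_iff₀ hre).2 (hγ.2.2 p hp).2
      have h2 := Real.arctan_mono h1
      rwa [Real.arctan_tan (by linarith [hγ.1, Real.pi_pos]) hγ.2.1] at h2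
    exact Real.strictMonoOn_tan.monotoneOn
      ⟨Real.neg_pi_div_two_lt_arctan _, Real.arctan_lt_pi_div_two _⟩
      ⟨by linarith [Real.pi_pos], hlt⟩ hle

end Hilbert

end LinRel

/-- A sesquilinear form in `E`, linear in the first entry and antilinear in the second, defined on
a (not necessarily dense) subspace. -/
structure SesqForm (E : Type*) [AddCommGroup E] [Module ℂ E] where
  /-- the domain of the form -/
  dom : Submodule ℂ E
  /-- the values of the form -/
  val : dom →ₗ[ℂ] dom →ₗ⋆[ℂ] ℂ

namespace SesqForm

variable {E : Type*} [NormedAddCommGroup E] [InnerProductSpace ℂ E]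

/-- The adjoint `t*[h, k] = conj t[k, h]` of a form `t` on the subspace `D`. -/
def adjointVal {D : Submodule ℂ E} (t : D →ₗ[ℂ] D →ₗ⋆[ℂ] ℂ) : D →ₗ[ℂ] D →ₗ⋆[ℂ] ℂ :=
  LinearMap.mk₂'ₛₗ (RingHom.id ℂ) (starRingEnd ℂ) (fun h k => conj (t k h))
    (by intros; simp) (by intros; simp) (by intros; simp) (by intros; simp)

/-- The real part `(t + t*) / 2` of a form. -/
def realPart (t : SesqForm E) : SesqForm E :=
  ⟨t.dom, (1 / 2 : ℂ) • (t.val + adjointVal t.val)⟩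

/-- The imaginary part `(t - t*) / (2 i)` of a form. -/
def imagPart (t : SesqForm E) : SesqForm E :=
  ⟨t.dom, (1 / (2 * Complex.I) : ℂ) • (t.val - adjointVal t.val)⟩

/-- The form is sectorial with vertex at the origin, for some semi-angle `α ∈ [0, π / 2)`.  The
diagonals of the real part and the imaginary part take real values. -/
def IsSectorial (t : SesqForm E) : Prop :=
  ∃ α : ℝ, 0 ≤ α ∧ α < Real.pi / 2 ∧
    ∀ h : t.dom, 0 ≤ (t.realPart.val h h).re ∧
      |(t.imagPart.val h h).re| ≤ Real.tan α * (t.realPart.val h h).re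

/-- The sectorial form `t` is closed: `hₙ → h` and `t[hₙ - hₘ] → 0` imply `h ∈ dom t` and
`t[hₙ - h] → 0`. -/
def IsClosed (t : SesqForm E) : Prop :=
  ∀ (u : ℕ → t.dom) (h : E),
    Filter.Tendsto (fun n => (u n : E)) Filter.atTop (nhds h) →
    Filter.Tendsto (fun q : ℕ × ℕ => t.val (u q.1 - u q.2) (u q.1 - u q.2)) Filter.atTop (nhds 0) →
    ∃ hd : h ∈ t.dom,
      Filter.Tendsto (fun n => t.val (u n - ⟨h, hd⟩) (u n - ⟨h, hd⟩)) Filter.atTop (nhds 0)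

/-- `dom H ⊆ dom t`, and `t[h, k] = (h', k)` for all `(h, h') ∈ H` and `k ∈ dom t`. -/
def Represents (t : SesqForm E) (H : Submodule ℂ (E × E)) : Prop :=
  ∀ p ∈ H, ∃ hd : p.1 ∈ t.dom, ∀ k : t.dom, t.val ⟨p.1, hd⟩ k = inner ℂ (k : E) p.2

/-- `t` is the closed sectorial form corresponding to the maximal sectorial relation `H`. -/
def IsFormOf (t : SesqForm E) (H : Submodule ℂ (E × E)) : Prop :=
  t.IsSectorial ∧ t.IsClosed ∧ t.Represents H

/-- `A` is the nonnegative selfadjoint relation corresponding to the real part of the form `t`.  When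
`t` is the form of the maximal sectorial relation `H`, this `A` is the real part of `H`. -/
def IsRealPartRel (t : SesqForm E) (A : Submodule ℂ (E × E)) : Prop :=
  LinRel.IsNonnegSelfAdjointIn ⊤ A ∧ t.realPart.Represents A

end SesqForm

end

/-! A closed sectorial form t makes its domain a Hilbert space V with inner product t_r + (·,·). The
inclusion j : V → E is an injective contraction and the imaginary part of t becomes a bounded
selfadjoint C on V, so t[jv, jw] = ((1 + iC)v, w)_V − (jv, jw) (`exists_model_of_isClosed`). Through
`formRel`, jv is related to h' exactly when Tv = j†(jv + h'); T = 1 + iC gives H and T = 1 gives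
H_r. The inclusions follow by testing against dom t; maximality of H and selfadjointness of H_r turn
them into equalities. Both multivalued parts are ker j†.

The square root S has domain jV and (Sjv, Sjw) = (v, w)_V − (jv, jw) (`IsSqrtIn.exists_of_mem`,
`IsSqrtIn.exists_mem`). So |(Cv, v)| ≤ tan α (‖v‖² − ‖jv‖²) bounds C by ‖Sjv‖², and C is transported
to an operator G on the closure of ran S, extended by zero (`IsSqrtIn.exists_operator`). The bound
holds with the semi-angle of H itself because dom H is a core (`IsSectorialWith.formRel_bound`).
Conversely arctan ‖G‖ is an admissible angle for H, so ‖G‖ = tan α. The factorization of H is the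
form identity tested against dom S (`formRel_eq_comp`).

For existence, the form (h', k) on H itself is completed (`exists_form`), and S is built from the
square roots of R = jj† = (H_r + 1)⁻¹ and 1 − R (`exists_isSqrtIn`). -/

open scoped ComplexConjugate

noncomputable section

universe u

/-! ### Bounded Hermitian forms and completions -/

section HilbertSpace

open InnerProductSpace

variable {X V E L : Type*} [AddCommGroup X] [Module ℂ X]
  [NormedAddCommGroup V] [InnerProductSpace ℂ V]
  [NormedAddCommGroup E] [InnerProductSpace ℂ E]
  [NormedAddCommGroup L] [InnerProductSpace ℂ L]

/-- A Hermitian form dominated on the diagonal by `M ‖D x‖ ^ 2` satisfies the corresponding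
Cauchy-Schwarz inequality. -/
theorem norm_hermitian_le_of_diag (b : X →ₗ⋆[ℂ] X →ₗ[ℂ] ℂ) (hb : ∀ x y, conj (b x y) = b y x)
    (D : X →ₗ[ℂ] L) {M : ℝ} (h : ∀ x, |(b x x).re| ≤ M * ‖D x‖ ^ 2) (x y : X) :
    ‖b x y‖ ≤ M * ‖D x‖ * ‖D y‖ := by
  have hre : ∀ x y, (b x y).re ≤ M / 2 * (‖D x‖ ^ 2 + ‖D y‖ ^ 2) := by
    intro x y
    have h1 := le_of_abs_le (h (x + y))
    have h2 := neg_le_of_abs_le (h (x - y))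
    have h3 : (b y x).re = (b x y).re := by rw [← hb x y, Complex.conj_re]
    have h4 := parallelogram_law_with_norm ℂ (D x) (D y)
    simp only [map_add, map_sub, LinearMap.add_apply, LinearMap.sub_apply, Complex.add_re,
      Complex.sub_re, h3] at h1 h2
    have h5 : M * (‖D x + D y‖ ^ 2 + ‖D x - D y‖ ^ 2) =
      M * (2 * (‖D x‖ ^ 2 + ‖D y‖ ^ 2)) := by rw [h4]
    linarith
  have hn : ∀ x y, ‖b x y‖ ≤ M / 2 * (‖D x‖ ^ 2 + ‖D y‖ ^ 2) := by
    intro x y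
    -- A unimodular factor on y rotates b x y onto its modulus and leaves ‖D y‖ unchanged.
    obtain ⟨u, hu, hu'⟩ := RCLike.exists_norm_eq_mul_self (b x y)
    have := hre x (u • y)
    rw [map_smul, smul_eq_mul, ← hu', map_smul, norm_smul, hu, one_mul] at this
    simpa using this
  -- Replacing x by r x gives a quadratic in r that is never negative; its discriminant yields the
  -- product bound.
  have hd : ∀ r : ℝ, 0 ≤ (M / 2 * ‖D x‖ ^ 2) * (r * r) + (-‖b x y‖) * r + M / 2 * ‖D y‖ ^ 2 := by
    intro r
    have h1 := hn ((r : ℂ) • x) y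
    simp only [map_smulₛₗ, LinearMap.smul_apply, norm_smul, RCLike.norm_conj, Complex.norm_real,
      Real.norm_eq_abs, mul_pow, sq_abs, smul_eq_mul, norm_mul, RingHom.id_apply] at h1
    nlinarith [le_abs_self r, norm_nonneg (b x y),
      mul_le_mul_of_nonneg_right (le_abs_self r) (norm_nonneg (b x y))]
  have hdisc := discrim_le_zero hd
  have hM : 0 ≤ M * ‖D x‖ * ‖D y‖ := by
    have h1 := (abs_nonneg _).trans (h x)
    rcases (norm_nonneg (D x)).eq_or_lt with h0 | h0
    · simp [← h0]
    -- The sign of M is not assumed; it is forced as soon as some D x is nonzero.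
    · have : 0 ≤ M := by
        by_contra hneg
        nlinarith [pow_pos h0 2]
      positivity
  rw [discrim] at hdisc
  refine abs_le_of_sq_le_sq' ?_ hM |>.2
  nlinarith

theorem eq_of_inner_denseRange {Y V : Type*} [NormedAddCommGroup V]
    [InnerProductSpace ℂ V] {e : Y → V} (he : DenseRange e) {v w : V}
    (h : ∀ x, inner ℂ (e x) v = inner ℂ (e x) w) : v = w := by
  refine ext_inner_left ℂ fun u => ?_
  exact he.induction_on (p := fun u => inner ℂ u v = inner ℂ u w) u
    (isClosed_eq (by fun_prop) (by fun_prop)) h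

/-- A Hermitian form that is bounded relative to a map `e` of dense range is given by a bounded
selfadjoint operator. -/
theorem exists_selfAdjoint_of_bounded [CompleteSpace V] (e : X →ₗ[ℂ] V) (he : DenseRange e)
    (b : X →ₗ⋆[ℂ] X →ₗ[ℂ] ℂ) (hb : ∀ x y, conj (b x y) = b y x) {M : ℝ} (hM : 0 ≤ M)
    (h : ∀ x y, ‖b x y‖ ≤ M * ‖e x‖ * ‖e y‖) :
    ∃ C : V →L[ℂ] V, IsSelfAdjoint C ∧ ‖C‖ ≤ M ∧ ∀ x y, inner ℂ (e x) (C (e y)) = b x y := by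
  let φ : X → V := fun x => (toDual ℂ V).symm ((b x).extendOfNorm e)
  have hφ : ∀ x y, inner ℂ (φ x) (e y) = b x y := by
    intro x y
    simp only [φ, toDual_symm_apply]
    exact LinearMap.extendOfNorm_eq he ⟨_, h x⟩ y
  have hφ' : ∀ x y, inner ℂ (e y) (φ x) = b y x := by
    intro x y
    rw [← inner_conj_symm, hφ, hb]
  let c : X →ₗ[ℂ] V :=
    { toFun := φ
      map_add' := fun x x' => eq_of_inner_denseRange he fun y => by
        simp [hφ']
      map_smul' := fun a x => eq_of_inner_denseRange he fun y => by
        simp [hφ'] }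
  have hc : ∀ x, ‖c x‖ ≤ M * ‖e x‖ := by
    intro x
    change ‖(toDual ℂ V).symm ((b x).extendOfNorm e)‖ ≤ _
    rw [LinearIsometryEquiv.norm_map]
    exact LinearMap.opNorm_extendOfNorm_le he (by positivity) (h x)
  have hC : ∀ x, c.extendOfNorm e (e x) = φ x := LinearMap.extendOfNorm_eq he ⟨M, hc⟩
  refine ⟨c.extendOfNorm e, ?_, LinearMap.opNorm_extendOfNorm_le he hM hc, fun x y => ?_⟩
  · rw [ContinuousLinearMap.isSelfAdjoint_iff_isSymmetric]
    intro v w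
    refine he.induction_on₂ (p := fun v w => inner ℂ (c.extendOfNorm e v) w =
      inner ℂ v (c.extendOfNorm e w)) (isClosed_eq (by fun_prop) (by fun_prop)) ?_ v w
    intro x y
    rw [hC, hC, hφ, hφ']
  · rw [hC, hφ']

/-- A Hermitian form that is bounded relative to a map `σ` is given by a bounded selfadjoint operator
which vanishes on the orthogonal complement of the range of `σ`. -/
theorem exists_selfAdjoint_vanishing [CompleteSpace E] (σ : X →ₗ[ℂ] E)
    (b : X →ₗ⋆[ℂ] X →ₗ[ℂ] ℂ) (hb : ∀ x y, conj (b x y) = b y x) {M : ℝ} (hM : 0 ≤ M)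
    (h : ∀ x y, ‖b x y‖ ≤ M * ‖σ x‖ * ‖σ y‖) :
    ∃ G : E →L[ℂ] E, IsSelfAdjoint G ∧ ‖G‖ ≤ M ∧
      (∀ x y, inner ℂ (σ x) (G (σ y)) = b x y) ∧
      ∀ z, (∀ x, inner ℂ (σ x) z = 0) → G z = 0 := by
  -- The operator is built on L, where σ has dense range, and then compressed with the orthogonal
  -- projection onto L.
  let L := (LinearMap.range σ).topologicalClosure
  have hL : ∀ x, σ x ∈ L := fun x => Submodule.le_topologicalClosure _ ⟨x, rfl⟩
  have : CompleteSpace L := (Submodule.isClosed_topologicalClosure _).completeSpace_coe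
  let σ' : X →ₗ[ℂ] L := σ.codRestrict L hL
  have hσ' : DenseRange σ' := by
    rw [DenseRange, Topology.IsInducing.subtypeVal.dense_iff]
    rintro ⟨x, hx⟩
    rw [← Set.range_comp]
    exact hx
  obtain ⟨C, hC, hCM, hCb⟩ := exists_selfAdjoint_of_bounded σ' hσ' b hb hM h
  refine ⟨L.subtypeL ∘L C ∘L ContinuousLinearMap.adjoint L.subtypeL, hC.conj_adjoint _, ?_,
    fun x y => ?_, fun z hz => ?_⟩
  · have h1 : ‖L.subtypeL‖ ≤ 1 := L.norm_subtypeL_le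
    have h2 : ‖ContinuousLinearMap.adjoint L.subtypeL‖ ≤ 1 := by
      rwa [LinearIsometryEquiv.norm_map]
    calc _ ≤ ‖L.subtypeL‖ * (‖C‖ * ‖ContinuousLinearMap.adjoint L.subtypeL‖) :=
          (ContinuousLinearMap.opNorm_comp_le _ _).trans
            (mul_le_mul_of_nonneg_left (ContinuousLinearMap.opNorm_comp_le _ _) (norm_nonneg _))
      _ ≤ 1 * (M * 1) := by gcongr
      _ = M := by ring
  · have h1 : ContinuousLinearMap.adjoint L.subtypeL (σ y) = σ' y := by
      refine ext_inner_left ℂ fun w => ?_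
      rw [ContinuousLinearMap.adjoint_inner_right]
      rfl
    rw [← hCb, ← h1]
    rw [show σ x = L.subtypeL (σ' x) from rfl, ContinuousLinearMap.comp_apply,
      ← ContinuousLinearMap.adjoint_inner_left, show L.subtypeL (σ' x) = σ x from rfl]
    have h2 : ContinuousLinearMap.adjoint L.subtypeL (σ x) = σ' x := by
      refine ext_inner_left ℂ fun w => ?_
      rw [ContinuousLinearMap.adjoint_inner_right]
      rfl
    rw [h2]
    rfl
  · have h1 : ContinuousLinearMap.adjoint L.subtypeL z = 0 := by
      refine eq_of_inner_denseRange hσ' fun x => ?_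
      rw [ContinuousLinearMap.adjoint_inner_right, inner_zero_right]
      exact hz x
    simp [h1]

/-- A vector whose inner products are bounded by `‖j† g‖` lies in the range of `j`. -/
theorem exists_eq_of_norm_inner_le [CompleteSpace V] [CompleteSpace E] (j : V →L[ℂ] E)
    (hj : DenseRange (ContinuousLinearMap.adjoint j)) {f : E} {c : ℝ}
    (h : ∀ g, ‖inner ℂ f g‖ ≤ c * ‖ContinuousLinearMap.adjoint j g‖) : ∃ v, j v = f := by
  let e : E →ₗ[ℂ] V := (ContinuousLinearMap.adjoint j : E →L[ℂ] V)
  -- The bound lets g ↦ ⟨f, g⟩ factor through j† as a bounded functional on V; its Riesz vector is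
  -- the preimage of f.
  let F := (innerₛₗ ℂ f).extendOfNorm e
  have hF : ∀ g, F (ContinuousLinearMap.adjoint j g) = inner ℂ f g :=
    LinearMap.extendOfNorm_eq (e := e) hj ⟨c, h⟩
  refine ⟨(toDual ℂ V).symm F, ext_inner_right ℂ fun g => ?_⟩
  rw [← ContinuousLinearMap.adjoint_inner_right, toDual_symm_apply, hF]

/-- The orthogonal complement of ran j† is ker j = 0. -/
theorem denseRange_adjoint [CompleteSpace V] [CompleteSpace E] (j : V →L[ℂ] E)
    (hj : Function.Injective j) : DenseRange (ContinuousLinearMap.adjoint j) := by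
  have : (LinearMap.range (ContinuousLinearMap.adjoint j : E →ₗ[ℂ] V)).topologicalClosure = ⊤ := by
    rw [Submodule.topologicalClosure_eq_top_iff, eq_bot_iff]
    intro v hv
    refine hj ?_
    rw [map_zero]
    refine ext_inner_left ℂ fun g => ?_
    rw [← ContinuousLinearMap.adjoint_inner_left, inner_zero_right]
    exact hv _ ⟨g, rfl⟩
  rw [DenseRange, dense_iff_closure_eq]
  exact congrArg (fun s : Submodule ℂ V => (s : Set V)) this

/-- The completion of a complex vector space for a positive semidefinite form. -/
theorem exists_completion {X : Type u} [AddCommGroup X] [Module ℂ X] (b : X →ₗ⋆[ℂ] X →ₗ[ℂ] ℂ)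
    (hb : ∀ x y, conj (b x y) = b y x) (hpos : ∀ x, 0 ≤ (b x x).re) :
    ∃ (V : Type u) (_ : NormedAddCommGroup V) (_ : InnerProductSpace ℂ V) (_ : CompleteSpace V)
      (e : X →ₗ[ℂ] V), DenseRange e ∧ ∀ x y, inner ℂ (e x) (e y) = b x y := by
  let core : PreInnerProductSpace.Core ℂ X :=
    { inner := fun x y => b x y
      conj_inner_symm := fun x y => hb y x
      re_inner_nonneg := hpos
      add_left := fun x y z => by simp
      smul_left := fun x y r => by simp }
  let : SeminormedAddCommGroup X := InnerProductSpace.Core.toSeminormedAddCommGroup (c := core)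
  let : InnerProductSpace ℂ X := InnerProductSpace.ofCore core
  exact ⟨UniformSpace.Completion X, inferInstance, inferInstance, inferInstance,
    (UniformSpace.Completion.toComplL (𝕜 := ℂ) (E := X)).toLinearMap,
    UniformSpace.Completion.denseRange_coe, fun x y => UniformSpace.Completion.inner_coe x y⟩

/-- A sectorial form `b` on `X`, relative to a map `ι : X → E`, in terms of the completion `V` of
`X`: here `j` extends `ι` and `C` is the operator of the imaginary part of `b`. -/
theorem exists_sectorial_model [CompleteSpace E] {X : Type u} [AddCommGroup X] [Module ℂ X]
    (ι : X →ₗ[ℂ] E) (b : X →ₗ⋆[ℂ] X →ₗ[ℂ] ℂ) {τ : ℝ} (hτ : 0 ≤ τ)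
    (hb : ∀ x, 0 ≤ (b x x).re ∧ |(b x x).im| ≤ τ * (b x x).re) :
    ∃ (V : Type u) (_ : NormedAddCommGroup V) (_ : InnerProductSpace ℂ V) (_ : CompleteSpace V)
      (e : X →ₗ[ℂ] V) (j : V →L[ℂ] E) (C : V →L[ℂ] V), DenseRange e ∧ (∀ x, j (e x) = ι x) ∧
      IsSelfAdjoint C ∧ (∀ v, ‖j v‖ ≤ ‖v‖) ∧
      (∀ v, |(inner ℂ v (C v)).re| ≤ τ * (‖v‖ ^ 2 - ‖j v‖ ^ 2)) ∧
      (∀ x y, inner ℂ (e x) (e y) = (1 / 2 : ℂ) * (b x y + conj (b y x)) + inner ℂ (ι x) (ι y)) ∧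
      ∀ x y, b x y = inner ℂ (e x) (e y + Complex.I • C (e y)) - inner ℂ (ι x) (ι y) := by
  have hadj : ∃ b' : X →ₗ⋆[ℂ] X →ₗ[ℂ] ℂ, ∀ x y, b' x y = conj (b y x) :=
    ⟨LinearMap.mk₂'ₛₗ (starRingEnd ℂ) (RingHom.id ℂ) (fun x y => conj (b y x))
      (by intros; simp) (by intros; simp) (by intros; simp) (by intros; simp), fun _ _ => rfl⟩
  obtain ⟨b', hb'⟩ := hadj
  let r : X →ₗ⋆[ℂ] X →ₗ[ℂ] ℂ := (1 / 2 : ℂ) • (b + b') +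
    LinearMap.mk₂'ₛₗ (starRingEnd ℂ) (RingHom.id ℂ) (fun x y => inner ℂ (ι x) (ι y))
      (by intros; simp) (by intros; simp [mul_comm])
      (by intros; simp) (by intros; simp)
  let i : X →ₗ⋆[ℂ] X →ₗ[ℂ] ℂ := (1 / (2 * Complex.I) : ℂ) • (b - b')
  have hr : ∀ x y, r x y = (1 / 2 : ℂ) * (b x y + conj (b y x)) + inner ℂ (ι x) (ι y) := by
    intro x y
    simp [r, hb', mul_add]
  have hi : ∀ x y, i x y = (1 / (2 * Complex.I) : ℂ) * (b x y - conj (b y x)) := by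
    intro x y
    simp [i, hb']
  have hrd : ∀ x, (r x x).re = (b x x).re + ‖ι x‖ ^ 2 := by
    intro x
    have h1 : (inner ℂ (ι x) (ι x)).re = ‖ι x‖ ^ 2 := inner_self_eq_norm_sq (𝕜 := ℂ) (ι x)
    rw [hr, Complex.add_re, h1, Complex.add_conj]
    simp
  have hid : ∀ x, (i x x).re = (b x x).im := by
    intro x
    rw [hi, Complex.sub_conj]
    have : (1 / (2 * Complex.I) : ℂ) * ((2 * (b x x).im : ℝ) * Complex.I) = ((b x x).im : ℝ) := by
      push_cast
      field_simp
    rw [this, Complex.ofReal_re]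
  obtain ⟨V, _, _, _, e, he, her⟩ := exists_completion r
    (fun x y => by simp only [hr, map_add, map_mul, inner_conj_symm, Complex.conj_conj]; simp [map_ofNat]; ring)
    (fun x => by rw [hrd]; nlinarith [(hb x).1])
  have hen : ∀ x, ‖e x‖ ^ 2 = (b x x).re + ‖ι x‖ ^ 2 := by
    intro x
    have h1 : (inner ℂ (e x) (e x)).re = ‖e x‖ ^ 2 := inner_self_eq_norm_sq (𝕜 := ℂ) (e x)
    rw [← h1, her, hrd]
  have hle : ∀ x, ‖ι x‖ ≤ 1 * ‖e x‖ := by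
    intro x
    rw [one_mul]
    exact le_of_sq_le_sq (by linarith [hen x, (hb x).1]) (norm_nonneg _)
  have hj : ∀ x, ι.extendOfNorm e (e x) = ι x := LinearMap.extendOfNorm_eq he ⟨1, hle⟩
  have hisymm : ∀ x y, conj (i x y) = i y x := by
    intro x y
    simp only [hi, map_mul, map_sub, Complex.conj_conj]
    simp [map_ofNat]
    ring
  obtain ⟨C, hC, -, hCi⟩ := exists_selfAdjoint_of_bounded e he i hisymm hτ
    (norm_hermitian_le_of_diag i hisymm e fun x => by
      rw [hid, hen]
      exact (hb x).2.trans (mul_le_mul_of_nonneg_left (by nlinarith) hτ))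
  refine ⟨V, _, _, _, e, ι.extendOfNorm e, C, he, hj, hC, fun v => ?_, fun v => ?_,
    fun x y => by rw [her, hr], fun x y => ?_⟩
  · simpa using LinearMap.norm_extendOfNorm_apply_le he 1 hle v
  · refine he.induction_on (p := fun v => |(inner ℂ v (C v)).re| ≤
      τ * (‖v‖ ^ 2 - ‖ι.extendOfNorm e v‖ ^ 2)) v (isClosed_le (by fun_prop) (by fun_prop)) ?_
    intro x
    rw [hCi, hid, hj, hen]
    simpa using (hb x).2
  · rw [inner_add_right, inner_smul_right, hCi, her, hr, hi]
    field_simp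
    ring

end HilbertSpace

/-! ### Relations generated by a form on V -/

namespace LinRel

section Relations

open ContinuousLinearMap (adjoint adjoint_inner_left adjoint_inner_right)

variable {V E : Type*} [NormedAddCommGroup V] [InnerProductSpace ℂ V] [CompleteSpace V]
  [NormedAddCommGroup E] [InnerProductSpace ℂ E] [CompleteSpace E]

/-- The relation in `E` of the form `(j v, j w) ↦ (T v, w) - (j v, j w)` on the range of
`j : V → E`. -/
def formRel (j : V →L[ℂ] E) (T : V →L[ℂ] V) : Submodule ℂ (E × E) where
  carrier := {p | ∃ v, j v = p.1 ∧ T v = adjoint j (p.1 + p.2)}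
  zero_mem' := ⟨0, by simp⟩
  add_mem' := by
    rintro p q ⟨v, hv, hv'⟩ ⟨w, hw, hw'⟩
    refine ⟨v + w, by simp [hv, hw], ?_⟩
    rw [map_add, hv', hw', ← map_add]
    congr 1
    simp only [Prod.fst_add, Prod.snd_add]
    abel
  smul_mem' := by
    rintro c p ⟨v, hv, hv'⟩
    exact ⟨c • v, by simp [hv], by simp [hv']⟩

theorem mem_formRel {j : V →L[ℂ] E} {T : V →L[ℂ] V} {p : E × E} :
    p ∈ formRel j T ↔ ∃ v, j v = p.1 ∧ T v = adjoint j (p.1 + p.2) := Iff.rfl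

/-- For T = 1 the vector v must be j†(h + h'), so the relation A satisfies (A + 1)⁻¹ = jj†. -/
theorem mem_formRel_one {j : V →L[ℂ] E} {p : E × E} :
    p ∈ formRel j 1 ↔ j (adjoint j (p.1 + p.2)) = p.1 := by
  rw [mem_formRel]
  constructor
  · rintro ⟨v, hv, hv'⟩
    rw [← hv', one_apply_eq_self, hv]
  · exact fun h => ⟨_, h, rfl⟩

theorem mem_mul_formRel {j : V →L[ℂ] E} (hj : Function.Injective j) {T : V →L[ℂ] V} {x : E} :
    x ∈ mul (formRel j T) ↔ adjoint j x = 0 := by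
  change ((0 : E), x) ∈ formRel j T ↔ _
  rw [mem_formRel]
  constructor
  · rintro ⟨v, hv, hv'⟩
    have : v = 0 := hj (by simpa using hv)
    simpa [this] using hv'.symm
  · exact fun h => ⟨0, by simp [h]⟩

/-- Pairing (1 + iC)v = j†(h + h') with v gives (h', h) = ‖v‖² − ‖jv‖² + i(Cv, v), and (Cv, v) is
real. -/
theorem inner_of_mem_formRel {j : V →L[ℂ] E} {C : V →L[ℂ] V} (hC : IsSelfAdjoint C) {p : E × E}
    {v : V} (hv : j v = p.1) (hv' : (1 + Complex.I • C) v = adjoint j (p.1 + p.2)) :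
    (inner ℂ p.1 p.2).re = ‖v‖ ^ 2 - ‖j v‖ ^ 2 ∧
      (inner ℂ p.1 p.2).im = (inner ℂ v (C v)).re := by
  have hreal : (inner ℂ v (C v)).im = 0 :=
    (ContinuousLinearMap.isSelfAdjoint_iff_isSymmetric.mp hC).im_inner_self_apply v
  have h1 : inner ℂ v v = ((‖v‖ ^ 2 : ℝ) : ℂ) := by
    rw [inner_self_eq_norm_sq_to_K]; norm_cast
  have h2 : inner ℂ (j v) (j v) = ((‖j v‖ ^ 2 : ℝ) : ℂ) := by
    rw [inner_self_eq_norm_sq_to_K]; norm_cast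
  have key : inner ℂ p.1 p.2 =
      ((‖v‖ ^ 2 - ‖j v‖ ^ 2 : ℝ) : ℂ) + Complex.I * inner ℂ v (C v) := by
    have h3 : inner ℂ p.1 p.2 = inner ℂ v (adjoint j (p.1 + p.2)) - inner ℂ (j v) (j v) := by
      rw [adjoint_inner_right, hv, inner_add_right]
      ring
    rw [h3, ← hv', h2]
    simp only [add_apply, one_apply_eq_self, smul_apply, inner_add_right, inner_smul_right, h1]
    push_cast
    ring
  rw [key]
  constructor <;> simp [hreal, -Complex.ofReal_sub, -Complex.ofReal_pow]

theorem formRel_isSectorialWith {j : V →L[ℂ] E} {C : V →L[ℂ] V} (hC : IsSelfAdjoint C) {α : ℝ}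
    (h0 : 0 ≤ α) (hα : α < Real.pi / 2) (hj : ∀ v, ‖j v‖ ≤ ‖v‖)
    (h : ∀ v, |(inner ℂ v (C v)).re| ≤ Real.tan α * (‖v‖ ^ 2 - ‖j v‖ ^ 2)) :
    IsSectorialWith (formRel j (1 + Complex.I • C)) α := by
  refine ⟨h0, hα, ?_⟩
  rintro p ⟨v, hv, hv'⟩
  obtain ⟨hre, him⟩ := inner_of_mem_formRel hC hv hv'
  rw [hre, him]
  exact ⟨sub_nonneg.2 (pow_le_pow_left₀ (norm_nonneg _) (hj v) 2), h v⟩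

/-- The spectrum of C is real, and 1 + iC = −i(i − C). -/
theorem isUnit_one_add_I_smul {C : V →L[ℂ] V} (hC : IsSelfAdjoint C) :
    IsUnit (1 + Complex.I • C) := by
  have h1 : Complex.I ∉ spectrum ℂ C := fun h => by
    simpa using hC.im_eq_zero_of_mem_spectrum h
  rw [spectrum.notMem_iff] at h1
  have h2 : (1 + Complex.I • C : V →L[ℂ] V) =
      algebraMap ℂ (V →L[ℂ] V) (-Complex.I) * (algebraMap ℂ (V →L[ℂ] V) Complex.I - C) := by
    rw [mul_sub, ← map_mul, Algebra.algebraMap_eq_smul_one, ← Algebra.smul_def]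
    simp
  rw [h2]
  exact ((IsUnit.mk0 (-Complex.I) (by simp)).map (algebraMap ℂ (V →L[ℂ] V))).mul h1

/-- The domain of `formRel j (1 + i C)` is a core, so that its semi-angle bounds the form. -/
theorem IsSectorialWith.formRel_bound {j : V →L[ℂ] E} (hj : Function.Injective j) {C : V →L[ℂ] V}
    (hC : IsSelfAdjoint C) {α : ℝ} (h : IsSectorialWith (formRel j (1 + Complex.I • C)) α) (v : V) :
    |(inner ℂ v (C v)).re| ≤ Real.tan α * (‖v‖ ^ 2 - ‖j v‖ ^ 2) := by
  obtain ⟨⟨T, T', hT, hT'⟩, rfl : T = _⟩ := isUnit_one_add_I_smul hC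
  have hsurj : Function.Surjective T' := fun w =>
    ⟨(1 + Complex.I • C) w, congrArg (fun A : V →L[ℂ] V => A w) hT'⟩
  -- The vectors (1 + iC)⁻¹ j† g are mapped by j into the domain of the relation and are dense in V,
  -- so the bound passes to all of V by continuity.
  have hd : DenseRange (T' ∘ adjoint j) :=
    hsurj.denseRange.comp (denseRange_adjoint j hj) T'.continuous
  refine hd.induction_on (p := fun v => |(inner ℂ v (C v)).re| ≤
    Real.tan α * (‖v‖ ^ 2 - ‖j v‖ ^ 2)) v (isClosed_le (by fun_prop) (by fun_prop)) fun g => ?_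
  have h1 : (1 + Complex.I • C) (T' (adjoint j g)) = adjoint j g :=
    congrArg (fun A : V →L[ℂ] V => A (adjoint j g)) hT
  have h2 : (1 + Complex.I • C) (T' (adjoint j g)) =
      adjoint j (j (T' (adjoint j g)) + (g - j (T' (adjoint j g)))) := by
    rw [h1, add_sub_cancel]
  have h3 := (h.2.2 (j (T' (adjoint j g)), g - j (T' (adjoint j g))) ⟨_, rfl, h2⟩).2
  obtain ⟨hre, him⟩ := inner_of_mem_formRel (p := (j (T' (adjoint j g)), g - j (T' (adjoint j g))))
    hC rfl h2
  rwa [hre, him] at h3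

theorem formRel_one_symm {j : V →L[ℂ] E} {p q : E × E} (hp : p ∈ formRel j 1)
    (hq : q ∈ formRel j 1) : inner ℂ q.2 p.1 = inner ℂ q.1 p.2 := by
  obtain ⟨v, hv, hv'⟩ := hp
  obtain ⟨w, hw, hw'⟩ := hq
  have h1 : inner ℂ (q.1 + q.2) p.1 = inner ℂ q.1 (p.1 + p.2) := by
    have hv'' : v = adjoint j (p.1 + p.2) := hv'
    have hw'' : w = adjoint j (q.1 + q.2) := hw'
    rw [← hv, ← adjoint_inner_left, ← hw'', ← hw, ← adjoint_inner_right, hv, ← hv'']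
  rw [inner_add_left, inner_add_right] at h1
  exact add_left_cancel h1

theorem formRel_one_isNonnegSelfAdjointIn {j : V →L[ℂ] E} (hj : ∀ v, ‖j v‖ ≤ ‖v‖) :
    IsNonnegSelfAdjointIn ⊤ (formRel j 1) := by
  refine ⟨le_antisymm ?_ ?_, ?_⟩
  · rintro p ⟨hp, -⟩
    rw [SetLike.mem_coe, Submodule.mem_adjoint_iff] at hp
    rw [mem_formRel_one]
    refine ext_inner_left ℂ fun g => ?_
    -- Each g gives the element (jj†g, g − jj†g) of the relation; testing against all of these
    -- recovers the resolvent identity.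
    have := hp (j (adjoint j g)) (g - j (adjoint j g)) (mem_formRel_one.2 (by simp))
    rw [← adjoint_inner_left, ← adjoint_inner_right, adjoint_inner_right, adjoint_inner_right,
      inner_add_right]
    rw [inner_sub_left] at this
    linear_combination -this
  · intro p hp
    refine ⟨?_, trivial, trivial⟩
    rw [SetLike.mem_coe, Submodule.mem_adjoint_iff]
    intro a b hab
    rw [formRel_one_symm hp hab, sub_self]
  · have := formRel_isSectorialWith (j := j) (C := 0) (α := 0) (IsSelfAdjoint.zero _) le_rfl
      (by positivity) hj (by simp)
    simp only [smul_zero, add_zero] at this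
    exact fun p hp => (this.2.2 p hp).1

/-- A selfadjoint relation has no proper symmetric extension. -/
theorem eq_formRel_one_of_le {j : V →L[ℂ] E} {A : Submodule ℂ (E × E)}
    (hA : IsNonnegSelfAdjointIn ⊤ A) (hle : A ≤ formRel j 1) : A = formRel j 1 := by
  refine le_antisymm hle fun p hp => ?_
  rw [← hA.1]
  refine ⟨?_, trivial, trivial⟩
  rw [SetLike.mem_coe, Submodule.mem_adjoint_iff]
  intro a b hab
  rw [formRel_one_symm hp (hle hab), sub_self]

end Relations

/-! ### Selfadjoint relations and single-valuedness of the square root -/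

section Sqrt

variable {E : Type*} [NormedAddCommGroup E] [InnerProductSpace ℂ E]

theorem IsNonnegSelfAdjointIn.inner_symm {K : Submodule ℂ E} {S : Submodule ℂ (E × E)}
    (hS : IsNonnegSelfAdjointIn K S) {p q : E × E} (hp : p ∈ S) (hq : q ∈ S) :
    inner ℂ q.2 p.1 = inner ℂ q.1 p.2 := by
  rw [← hS.1] at hp
  exact sub_eq_zero.1 ((Submodule.mem_adjoint_iff _ _).1 hp.1 q.1 q.2 hq)

theorem IsNonnegSelfAdjointIn.mem {K : Submodule ℂ E} {S : Submodule ℂ (E × E)}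
    (hS : IsNonnegSelfAdjointIn K S) {p : E × E} (hp : p ∈ S) : p.1 ∈ K ∧ p.2 ∈ K := by
  rw [← hS.1] at hp
  exact hp.2

theorem IsNonnegSelfAdjointIn.isClosed {M : Submodule ℂ E} {S : Submodule ℂ (E × E)}
    (hS : IsNonnegSelfAdjointIn Mᗮ S) : IsClosed (S : Set (E × E)) := by
  have : (S : Set (E × E)) = (⋂ q ∈ S, {p | inner ℂ q.2 p.1 - inner ℂ q.1 p.2 = 0}) ∩
      ((Mᗮ : Set E) ×ˢ (Mᗮ : Set E)) := by
    conv_lhs => rw [← hS.1]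
    ext p
    simp [adjointIn, Submodule.mem_adjoint_iff]
  rw [this]
  refine IsClosed.inter (isClosed_biInter fun q _ => isClosed_eq (by fun_prop) (by fun_prop)) ?_
  exact M.isClosed_orthogonal.prod M.isClosed_orthogonal

/-- Since (0, 0) ∈ S, the multivalued part of S lies in that of S S, the operator part of A. There
it would lie both in `mul A` and in its orthogonal complement. -/
theorem IsSqrtIn.unique {A S : Submodule ℂ (E × E)} (hS : IsSqrtIn (mul A)ᗮ S (opPart A))
    {x s s' : E} (h : (x, s) ∈ S) (h' : (x, s') ∈ S) : s = s' := by
  have h0 : ((0 : E), s - s') ∈ S := by simpa using S.sub_mem h h'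
  have h1 : ((0 : E), s - s') ∈ opPart A := by
    rw [← hS.2]
    exact ⟨0, S.zero_mem, h0⟩
  rw [← sub_eq_zero, ← inner_self_eq_zero (𝕜 := ℂ)]
  exact h1.2.2 _ h1.1

end Sqrt

end LinRel

/-! ### Domain and inner products of the square root -/

namespace LinRel

section SqrtForm

open ContinuousLinearMap (adjoint adjoint_inner_left adjoint_inner_right)

variable {V E : Type*} [NormedAddCommGroup V] [InnerProductSpace ℂ V] [CompleteSpace V]
  [NormedAddCommGroup E] [InnerProductSpace ℂ E] [CompleteSpace E]

theorem isClosed_mul_formRel {j : V →L[ℂ] E} (hj : Function.Injective j) {T : V →L[ℂ] V} :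
    IsClosed (mul (formRel j T) : Set E) := by
  have : (mul (formRel j T) : Set E) = {x | adjoint j x = 0} := by
    ext x
    exact mem_mul_formRel hj
  rw [this]
  exact isClosed_eq (by fun_prop) (by fun_prop)

/-- Every `g` splits into a part in the kernel of `j†` and a part `a + a'` with `(a, a')` in the
operator part of `formRel j 1`. -/
theorem exists_mem_opPart {j : V →L[ℂ] E} (hj : Function.Injective j) (g : E) :
    ∃ a', (j (adjoint j g), a') ∈ opPart (formRel j 1) ∧
      g - j (adjoint j g) - a' ∈ mul (formRel j 1) := by
  have hcl := isClosed_mul_formRel hj (T := 1)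
  have : CompleteSpace (mul (formRel j 1)) := hcl.completeSpace_coe
  obtain ⟨m, hm, k, hk, rfl⟩ := (mul (formRel j 1)).exists_add_mem_mem_orthogonal g
  have hm' := (mem_mul_formRel hj).1 hm
  refine ⟨k - j (adjoint j (m + k)), ⟨mem_formRel_one.2 (by simp [hm']), trivial, ?_⟩, ?_⟩
  · refine Submodule.sub_mem _ hk fun x hx => ?_
    rw [← adjoint_inner_left, (mem_mul_formRel hj).1 hx, inner_zero_left]
  · convert hm using 1
    abel

/-- On the domain of S² everything is explicit: with a = jj†g and u = Sa, symmetry gives (Sp, u) =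
(p, S²a), and S²a differs from g − a by an element of `mul`, which is orthogonal to dom S. Taking p
= a yields ‖u‖² = ‖j†g‖² − ‖a‖². -/
theorem exists_mem_sqrt {j : V →L[ℂ] E} (hj : Function.Injective j) {S : Submodule ℂ (E × E)}
    (hS : IsSqrtIn (mul (formRel j 1))ᗮ S (opPart (formRel j 1))) (g : E) :
    ∃ u, (j (adjoint j g), u) ∈ S ∧ ‖u‖ ≤ ‖adjoint j g‖ ∧ ∀ p ∈ S,
      inner ℂ u p.2 = inner ℂ g p.1 - inner ℂ (j (adjoint j g)) p.1 := by
  obtain ⟨a', ha', hm⟩ := exists_mem_opPart hj g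
  rw [← hS.2] at ha'
  obtain ⟨u, hu, hu'⟩ := ha'
  have key : ∀ p ∈ S, inner ℂ u p.2 = inner ℂ g p.1 - inner ℂ (j (adjoint j g)) p.1 := by
    intro p hp
    have h1 := hS.1.inner_symm hp hu'
    have h2 := (hS.1.mem hp).1 _ hm
    rw [inner_sub_left, inner_sub_left] at h2
    simp only at h1
    rw [← h1]
    linear_combination -h2
  refine ⟨u, hu, ?_, key⟩
  have h4 := congrArg Complex.re (key _ hu)
  rw [← adjoint_inner_left, Complex.sub_re] at h4
  have h5 : (inner ℂ u u).re = ‖u‖ ^ 2 := inner_self_eq_norm_sq (𝕜 := ℂ) u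
  have h6 : (inner ℂ (j (adjoint j g)) (j (adjoint j g))).re = ‖j (adjoint j g)‖ ^ 2 :=
    inner_self_eq_norm_sq (𝕜 := ℂ) _
  have h7 : (inner ℂ (adjoint j g) (adjoint j g)).re = ‖adjoint j g‖ ^ 2 :=
    inner_self_eq_norm_sq (𝕜 := ℂ) _
  rw [h5, h6, h7] at h4
  exact le_of_sq_le_sq (by nlinarith [sq_nonneg ‖j (adjoint j g)‖]) (norm_nonneg _)

/-- This is dom S ⊆ jV: pairing g with a vector of dom S is controlled by ‖j†g‖, through
`exists_mem_sqrt`. -/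
theorem IsSqrtIn.exists_of_mem {j : V →L[ℂ] E} (hj : Function.Injective j)
    (hle : ∀ v, ‖j v‖ ≤ ‖v‖) {S : Submodule ℂ (E × E)}
    (hS : IsSqrtIn (mul (formRel j 1))ᗮ S (opPart (formRel j 1))) {p : E × E} (hp : p ∈ S) :
    ∃ v, j v = p.1 := by
  refine exists_eq_of_norm_inner_le j (denseRange_adjoint j hj) (c := ‖p.1‖ + ‖p.2‖) fun g => ?_
  obtain ⟨u, hu, hle', hu'⟩ := exists_mem_sqrt hj hS g
  have h4 : inner ℂ g p.1 = inner ℂ u p.2 + inner ℂ (j (adjoint j g)) p.1 := by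
    rw [hu' p hp]
    ring
  rw [norm_inner_symm, h4]
  calc _ ≤ ‖u‖ * ‖p.2‖ + ‖j (adjoint j g)‖ * ‖p.1‖ :=
        (norm_add_le _ _).trans (add_le_add (norm_inner_le_norm _ _) (norm_inner_le_norm _ _))
    _ ≤ ‖adjoint j g‖ * ‖p.2‖ + ‖adjoint j g‖ * ‖p.1‖ := by
        gcongr
        exact hle _
    _ = _ := by ring

/-- The reverse inclusion jV ⊆ dom S: w is approximated in V by vectors j†g, along which the values
of S are Cauchy, and S is closed. -/
theorem IsSqrtIn.exists_mem {j : V →L[ℂ] E} (hj : Function.Injective j)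
    {S : Submodule ℂ (E × E)}
    (hS : IsSqrtIn (mul (formRel j 1))ᗮ S (opPart (formRel j 1))) (w : V) :
    ∃ u, (j w, u) ∈ S ∧ ∀ v s, (j v, s) ∈ S →
      inner ℂ u s = inner ℂ w v - inner ℂ (j w) (j v) := by
  choose u hu hle hu' using exists_mem_sqrt hj hS
  have hadd : ∀ g g', u (g - g') = u g - u g' := by
    intro g g'
    refine hS.unique (hu _) ?_
    simpa using S.sub_mem (hu g) (hu g')
  obtain ⟨x, hx, hxw⟩ := mem_closure_iff_seq_limit.1 (denseRange_adjoint j hj w)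
  choose g hg using hx
  obtain rfl : (fun n => adjoint j (g n)) = x := funext hg
  have hcau : CauchySeq fun n => u (g n) := by
    refine Metric.cauchySeq_iff.2 fun ε hε => ?_
    obtain ⟨N, hN⟩ := Metric.cauchySeq_iff.1 hxw.cauchySeq ε hε
    refine ⟨N, fun m hm n hn => lt_of_le_of_lt ?_ (hN m hm n hn)⟩
    rw [dist_eq_norm, dist_eq_norm, ← hadd, ← map_sub]
    exact hle _
  obtain ⟨y, hy⟩ := cauchySeq_tendsto_of_complete hcau
  have hjw : Filter.Tendsto (fun n => j (adjoint j (g n))) Filter.atTop (nhds (j w)) :=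
    (j.continuous.tendsto w).comp hxw
  refine ⟨y, hS.1.isClosed.mem_of_tendsto (hjw.prodMk_nhds hy)
    (Filter.Eventually.of_forall fun n => hu (g n)), fun v s hs => ?_⟩
  refine tendsto_nhds_unique (hy.inner tendsto_const_nhds) ?_
  have h1 : ∀ n, inner ℂ (u (g n)) s =
      inner ℂ (adjoint j (g n)) v - inner ℂ (j (adjoint j (g n))) (j v) := fun n => by
    rw [hu' _ _ hs, adjoint_inner_left]
  simp only [h1]
  exact (hxw.inner tendsto_const_nhds).sub (hjw.inner tendsto_const_nhds)

end SqrtForm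

/-! ### Existence of the square root -/

section SqrtExistence

open ContinuousLinearMap (adjoint adjoint_inner_left adjoint_inner_right)

variable {E : Type*} [NormedAddCommGroup E] [InnerProductSpace ℂ E]

/-- The relation `{(Q x, P x) | x ∈ K}`. -/
def paramRel (Q P : E →L[ℂ] E) (K : Submodule ℂ E) : Submodule ℂ (E × E) :=
  K.map ((Q : E →ₗ[ℂ] E).prod (P : E →ₗ[ℂ] E))

theorem mem_paramRel {Q P : E →L[ℂ] E} {K : Submodule ℂ E} {p : E × E} :
    p ∈ paramRel Q P K ↔ ∃ x ∈ K, Q x = p.1 ∧ P x = p.2 := by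
  simp [paramRel, Prod.ext_iff]

variable [CompleteSpace E]

/-- The relation is formally P Q⁻¹, with Q and P playing cosine and sine. A pair (y, y') in the
adjoint satisfies Py = Qy', and Q² + P² = 1 recovers its parameter as Qy + Py'. -/
theorem paramRel_isNonnegSelfAdjointIn {Q P : E →L[ℂ] E} {K : Submodule ℂ E} (hQ : 0 ≤ Q)
    (hP : 0 ≤ P) (hPQ : Commute Q P) (hsq : Q * Q + P * P = 1) (hQK : ∀ x ∈ K, Q x ∈ K)
    (hPK : ∀ x ∈ K, P x ∈ K) (hK : ∀ x ∈ K, (∀ y ∈ K, inner ℂ y x = 0) → x = 0) :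
    IsNonnegSelfAdjointIn K (paramRel Q P K) := by
  have hQs := ((ContinuousLinearMap.nonneg_iff_isPositive Q).1 hQ).isSymmetric
  have hPs := ((ContinuousLinearMap.nonneg_iff_isPositive P).1 hP).isSymmetric
  have hcomm : ∀ x, Q (P x) = P (Q x) := fun x => congrArg (fun A : E →L[ℂ] E => A x) hPQ.eq
  have hone : ∀ x, Q (Q x) + P (P x) = x := fun x => congrArg (fun A : E →L[ℂ] E => A x) hsq
  refine ⟨le_antisymm ?_ ?_, ?_⟩
  · rintro ⟨y, y'⟩ ⟨hy, hyK, hyK'⟩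
    rw [SetLike.mem_coe, Submodule.mem_adjoint_iff] at hy
    have h1 : P y = Q y' := by
      rw [← sub_eq_zero]
      refine hK _ (K.sub_mem (hPK _ hyK) (hQK _ hyK')) fun x hx => ?_
      have h2 := hy (Q x) (P x) (mem_paramRel.2 ⟨x, hx, rfl, rfl⟩)
      rw [inner_sub_right, ← h2]
      congr 1
      · exact (hPs x y).symm
      · exact (hQs x y').symm
    refine mem_paramRel.2 ⟨Q y + P y', K.add_mem (hQK _ hyK) (hPK _ hyK'), ?_, ?_⟩
    · rw [map_add, hcomm, ← h1, hone]
    · rw [map_add, ← hcomm, h1, hone]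
  · intro p hp
    obtain ⟨x, hx, h1, h2⟩ := mem_paramRel.1 hp
    refine ⟨?_, h1 ▸ hQK x hx, h2 ▸ hPK x hx⟩
    rw [SetLike.mem_coe, Submodule.mem_adjoint_iff]
    intro a b hab
    obtain ⟨z, hz, h3, h4⟩ := mem_paramRel.1 hab
    simp only at h3 h4
    rw [← h1, ← h2, ← h3, ← h4, sub_eq_zero]
    have h5 := hPs z (Q x)
    have h6 := hQs z (P x)
    simp only [ContinuousLinearMap.coe_coe] at h5 h6
    rw [h5, h6, hcomm]
  · intro p hp
    obtain ⟨x, hx, h1, h2⟩ := mem_paramRel.1 hp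
    have h3 : 0 ≤ Q * P := Commute.mul_nonneg hQ hP hPQ
    have h4 := ((ContinuousLinearMap.nonneg_iff_isPositive _).1 h3).re_inner_nonneg_right x
    rw [← h1, ← h2]
    have h5 := hQs x (P x)
    simp only [ContinuousLinearMap.coe_coe] at h5
    rw [h5]
    exact h4

variable {V : Type*} [NormedAddCommGroup V] [InnerProductSpace ℂ V] [CompleteSpace V]

theorem exists_isSqrtIn {j : V →L[ℂ] E} (hj : Function.Injective j) (hle : ∀ v, ‖j v‖ ≤ ‖v‖) :
    ∃ S, IsSqrtIn (mul (formRel j 1))ᗮ S (opPart (formRel j 1)) := by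
  set R : E →L[ℂ] E := j ∘L adjoint j
  have hR0 : 0 ≤ R := by
    rw [ContinuousLinearMap.nonneg_iff_isPositive]
    exact ContinuousLinearMap.isPositive_self_comp_adjoint j
  have hR1 : 0 ≤ 1 - R := by
    rw [ContinuousLinearMap.nonneg_iff_isPositive]
    have hj1 : ‖adjoint j‖ ≤ 1 := by
      rw [LinearIsometryEquiv.norm_map]
      exact j.opNorm_le_bound zero_le_one (by simpa using hle)
    refine ⟨ContinuousLinearMap.isPositive_one.isSymmetric.sub
      ((ContinuousLinearMap.nonneg_iff_isPositive R).1 hR0).isSymmetric, fun x => ?_⟩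
    have h1 : ‖adjoint j x‖ ≤ ‖x‖ := by
      simpa using (adjoint j).le_of_opNorm_le hj1 x
    have h2 : (inner ℂ x x).re = ‖x‖ ^ 2 := inner_self_eq_norm_sq (𝕜 := ℂ) x
    have h3 : (inner ℂ (adjoint j x) (adjoint j x)).re = ‖adjoint j x‖ ^ 2 :=
      inner_self_eq_norm_sq (𝕜 := ℂ) _
    change 0 ≤ (inner ℂ (x - j (adjoint j x)) x).re
    rw [inner_sub_left, ← adjoint_inner_right, Complex.sub_re, h2, h3, sub_nonneg]
    exact pow_le_pow_left₀ (norm_nonneg _) h1 2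
  set Q := CFC.sqrt R
  set P := CFC.sqrt (1 - R)
  have hQQ : Q * Q = R := CFC.sqrt_mul_sqrt_self R hR0
  have hPP : P * P = 1 - R := CFC.sqrt_mul_sqrt_self (1 - R) hR1
  have hQP : Commute Q P := by
    have h1 : Commute R (1 - R) := (Commute.one_right R).sub_right (Commute.refl R)
    exact ((h1.cfcₙ_nnreal NNReal.sqrt).symm.cfcₙ_nnreal NNReal.sqrt).symm
  set K := (mul (formRel j 1))ᗮ
  have hQ : 0 ≤ Q := CFC.sqrt_nonneg R
  have hP : 0 ≤ P := CFC.sqrt_nonneg (1 - R)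
  have hQs := ((ContinuousLinearMap.nonneg_iff_isPositive Q).1 hQ).isSymmetric
  have hPs := ((ContinuousLinearMap.nonneg_iff_isPositive P).1 hP).isSymmetric
  have hQR : Commute Q R := by rw [← hQQ]; exact (Commute.refl Q).mul_right (Commute.refl Q)
  have hPR : Commute P R := by rw [← hQQ]; exact hQP.symm.mul_right hQP.symm
  -- A symmetric W commuting with jj† preserves ker j†, by injectivity of j, hence also its
  -- orthogonal complement K.
  have hinv : ∀ W : E →L[ℂ] E, (W : E →ₗ[ℂ] E).IsSymmetric → Commute W R → ∀ x ∈ K, W x ∈ K := by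
    intro W hW hWR x hx m hm
    rw [← ContinuousLinearMap.coe_coe W, ← hW m x]
    refine hx _ ?_
    rw [ContinuousLinearMap.coe_coe, mem_mul_formRel hj]
    refine hj ?_
    have : j (adjoint j (W m)) = W (j (adjoint j m)) :=
      congrArg (fun A : E →L[ℂ] E => A m) hWR.eq.symm
    rw [this, (mem_mul_formRel hj).1 hm, map_zero, map_zero]
  have hcomm : ∀ x, Q (P x) = P (Q x) := fun x => congrArg (fun A : E →L[ℂ] E => A x) hQP.eq
  have hQQ' : ∀ x, Q (Q x) = j (adjoint j x) := fun x => congrArg (fun A : E →L[ℂ] E => A x) hQQ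
  have hPP' : ∀ x, P (P x) = x - Q (Q x) := fun x => by
    rw [hQQ']
    exact congrArg (fun A : E →L[ℂ] E => A x) hPP
  refine ⟨paramRel Q P K, paramRel_isNonnegSelfAdjointIn hQ hP hQP (by rw [hQQ, hPP]; abel)
    (hinv Q hQs hQR) (hinv P hPs hPR) (fun x hx h => inner_self_eq_zero.1 (h x hx)), ?_⟩
  ext ⟨a, a'⟩
  constructor
  · rintro ⟨f, hf, hf'⟩
    obtain ⟨x, hx, h1, h2⟩ := mem_paramRel.1 hf
    obtain ⟨z, hz, h3, h4⟩ := mem_paramRel.1 hf'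
    simp only at h1 h2 h3 h4
    refine ⟨mem_formRel_one.2 ?_, trivial, h4 ▸ hinv P hPs hPR z hz⟩
    -- Here a = Qx, a' = Pz and Qz = Px, so Q(a + a') = Q²x + P²x = x.
    have h5 : Q (a + a') = x := by
      rw [← h1, ← h4, map_add, hcomm, h3, ← h2, hPP']
      abel
    rw [← hQQ']
    change Q (Q (a + a')) = a
    rw [h5, h1]
  · rintro ⟨h1, -, h2⟩
    replace h1 := mem_formRel_one.1 h1
    rw [← hQQ'] at h1
    simp only at h1 h2
    have ha : a ∈ K := by
      intro m hm
      rw [← h1, hQQ', ← adjoint_inner_left, (mem_mul_formRel hj).1 hm, inner_zero_left]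
    have hg := K.add_mem ha h2
    -- Since Q²(a + a') = a, the parameters Q(a + a') and P(a + a') describe two steps meeting at
    -- PQ(a + a').
    refine ⟨P (Q (a + a')), mem_paramRel.2 ⟨Q (a + a'), hinv Q hQs hQR _ hg, h1, rfl⟩,
      mem_paramRel.2 ⟨P (a + a'), hinv P hPs hPR _ hg, hcomm _, ?_⟩⟩
    rw [hPP', h1]
    simp

end SqrtExistence

end LinRel

/-! ### Forms defined by V, j and C -/

namespace SesqForm

open ContinuousLinearMap (adjoint adjoint_inner_left adjoint_inner_right)
open Filter Topology

theorem tendsto_norm_zero_of_sq {ι V : Type*} [NormedAddCommGroup V] {l : Filter ι} {f : ι → V}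
    (h : Tendsto (fun i => ‖f i‖ ^ 2) l (𝓝 0)) : Tendsto (fun i => ‖f i‖) l (𝓝 0) := by
  have := (Real.continuous_sqrt.tendsto 0).comp h
  simpa only [Function.comp_def, Real.sqrt_zero, Real.sqrt_sq (norm_nonneg _)] using this

section Parts

variable {E : Type*} [NormedAddCommGroup E] [InnerProductSpace ℂ E]

theorem realPart_apply (t : SesqForm E) (h k : t.dom) :
    t.realPart.val h k = (1 / 2 : ℂ) * (t.val h k + conj (t.val k h)) := rfl

theorem imagPart_apply (t : SesqForm E) (h k : t.dom) :
    t.imagPart.val h k = (1 / (2 * Complex.I) : ℂ) * (t.val h k - conj (t.val k h)) := rfl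

theorem realPart_self_re (t : SesqForm E) (h : t.dom) :
    (t.realPart.val h h).re = (t.val h h).re := by
  rw [realPart_apply, Complex.add_conj]
  simp

theorem imagPart_self_re (t : SesqForm E) (h : t.dom) :
    (t.imagPart.val h h).re = (t.val h h).im := by
  rw [imagPart_apply, Complex.sub_conj]
  have : (1 / (2 * Complex.I) : ℂ) * ((2 * (t.val h h).im : ℝ) * Complex.I) =
      ((t.val h h).im : ℝ) := by
    push_cast
    field_simp
  rw [this, Complex.ofReal_re]

end Parts

section Model

variable {V E : Type*} [NormedAddCommGroup V] [InnerProductSpace ℂ V]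
  [NormedAddCommGroup E] [InnerProductSpace ℂ E]

/-- The form `(j v, j w) ↦ (T v, w) - (j v, j w)` on the range of `j : V → E`. -/
def ofModel (j : V →L[ℂ] E) (hj : Function.Injective j) (T : V →L[ℂ] V) : SesqForm E where
  dom := LinearMap.range (j : V →ₗ[ℂ] E)
  val :=
    let r := ((LinearEquiv.ofInjective (j : V →ₗ[ℂ] E) hj).symm : _ →ₗ[ℂ] V)
    LinearMap.mk₂'ₛₗ (RingHom.id ℂ) (starRingEnd ℂ)
      (fun h k => inner ℂ (r k) (T (r h)) - inner ℂ (k : E) h)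
      (by intros; simp only [map_add, inner_add_right, Submodule.coe_add]; ring)
      (by intros; simp only [map_smul, inner_smul_right, Submodule.coe_smul, RingHom.id_apply,
        smul_eq_mul]; ring)
      (by intros; simp only [map_add, inner_add_left, Submodule.coe_add]; ring)
      (by intros; simp only [map_smul, inner_smul_left, Submodule.coe_smul, smul_eq_mul]; ring)

variable {j : V →L[ℂ] E} {hj : Function.Injective j}

theorem ofModel_dom_exists {T : V →L[ℂ] V} (h : (ofModel j hj T).dom) : ∃ v, j v = h := h.2

theorem ofModel_val {T : V →L[ℂ] V} {h k : (ofModel j hj T).dom} {v w : V} (hv : j v = h)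
    (hw : j w = k) : (ofModel j hj T).val h k = inner ℂ w (T v) - inner ℂ (k : E) h := by
  have h1 : ∀ {x : V} {y : (ofModel j hj T).dom}, j x = y →
      (LinearEquiv.ofInjective (j : V →ₗ[ℂ] E) hj).symm y = x := by
    intro x y hxy
    exact (LinearEquiv.symm_apply_eq _).2 (Subtype.ext hxy.symm)
  have h2 : (ofModel j hj T).val h k =
      inner ℂ ((LinearEquiv.ofInjective (j : V →ₗ[ℂ] E) hj).symm k)
        (T ((LinearEquiv.ofInjective (j : V →ₗ[ℂ] E) hj).symm h)) - inner ℂ (k : E) h := rfl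
  rw [h2, h1 hv, h1 hw]

variable [CompleteSpace V]

theorem ofModel_realPart_val {C : V →L[ℂ] V} (hC : IsSelfAdjoint C)
    {h k : (ofModel j hj (1 + Complex.I • C)).dom} {v w : V} (hv : j v = h) (hw : j w = k) :
    (ofModel j hj (1 + Complex.I • C)).realPart.val h k = inner ℂ w v - inner ℂ (k : E) h := by
  have h1 : inner ℂ (C w) v = inner ℂ w (C v) :=
    ContinuousLinearMap.isSelfAdjoint_iff_isSymmetric.mp hC w v
  rw [realPart_apply, ofModel_val hv hw, ofModel_val hw hv]
  simp only [add_apply, one_apply_eq_self, smul_apply, inner_add_right, inner_smul_right, map_sub,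
    inner_conj_symm, map_add, map_mul, Complex.conj_I, h1]
  ring

theorem ofModel_self_re {C : V →L[ℂ] V} (hC : IsSelfAdjoint C)
    {h : (ofModel j hj (1 + Complex.I • C)).dom} {v : V} (hv : j v = h) :
    ((ofModel j hj (1 + Complex.I • C)).val h h).re = ‖v‖ ^ 2 - ‖(h : E)‖ ^ 2 := by
  have h2 : (inner ℂ v v).re = ‖v‖ ^ 2 := inner_self_eq_norm_sq (𝕜 := ℂ) v
  have h3 : (inner ℂ (h : E) h).re = ‖(h : E)‖ ^ 2 := inner_self_eq_norm_sq (𝕜 := ℂ) _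
  rw [← realPart_self_re, ofModel_realPart_val hC hv hv, Complex.sub_re, h2, h3]

theorem ofModel_isSectorial {C : V →L[ℂ] V} (hC : IsSelfAdjoint C) {α : ℝ}
    (h0 : 0 ≤ α) (hα : α < Real.pi / 2) (hle : ∀ v, ‖j v‖ ≤ ‖v‖)
    (h : ∀ v, |(inner ℂ v (C v)).re| ≤ Real.tan α * (‖v‖ ^ 2 - ‖j v‖ ^ 2)) :
    (ofModel j hj (1 + Complex.I • C)).IsSectorial := by
  refine ⟨α, h0, hα, fun x => ?_⟩
  obtain ⟨v, hv⟩ := ofModel_dom_exists x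
  have him : ((ofModel j hj (1 + Complex.I • C)).val x x).im = (inner ℂ v (C v)).re := by
    have h2 : (inner ℂ v v).im = 0 := inner_self_im (𝕜 := ℂ) v
    have h3 : (inner ℂ (x : E) x).im = 0 := inner_self_im (𝕜 := ℂ) _
    rw [ofModel_val hv hv]
    simp only [add_apply, one_apply_eq_self, smul_apply, inner_add_right, inner_smul_right,
      Complex.sub_im, Complex.add_im, h2, h3, Complex.I_mul_im]
    ring
  rw [realPart_self_re, imagPart_self_re, ofModel_self_re hC hv, him, ← hv]
  exact ⟨sub_nonneg.2 (pow_le_pow_left₀ (norm_nonneg _) (hle v) 2), h v⟩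

/-- Because ‖v‖² = Re t[jv, jv] + ‖jv‖², form convergence is Cauchy convergence in the complete
space V. -/
theorem ofModel_isClosed {C : V →L[ℂ] V} (hC : IsSelfAdjoint C) :
    (ofModel j hj (1 + Complex.I • C)).IsClosed := by
  intro u h hu hcau
  choose v hv using fun n => ofModel_dom_exists (u n)
  have hv' : ∀ m n, j (v m - v n) = (u m - u n : (ofModel j hj (1 + Complex.I • C)).dom) := by
    intro m n
    rw [map_sub, hv, hv]
    rfl
  have h1 : ∀ q : ℕ × ℕ, ‖v q.1 - v q.2‖ ^ 2 =
      ((ofModel j hj (1 + Complex.I • C)).val (u q.1 - u q.2) (u q.1 - u q.2)).re +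
        ‖(u q.1 : E) - u q.2‖ ^ 2 := by
    intro q
    rw [ofModel_self_re hC (hv' q.1 q.2)]
    simp
  have h2 : Tendsto (fun q : ℕ × ℕ => ‖(u q.1 : E) - u q.2‖) atTop (𝓝 0) := by
    simpa only [dist_eq_norm] using cauchySeq_iff_tendsto_dist_atTop_0.1 hu.cauchySeq
  have h3 : Tendsto (fun q : ℕ × ℕ => ‖v q.1 - v q.2‖ ^ 2) atTop (𝓝 0) := by
    simp only [h1]
    simpa using ((Complex.continuous_re.tendsto 0).comp hcau).add (h2.pow 2)
  have h4 : CauchySeq v := by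
    rw [cauchySeq_iff_tendsto_dist_atTop_0]
    simpa only [dist_eq_norm] using tendsto_norm_zero_of_sq h3
  obtain ⟨w, hw⟩ := cauchySeq_tendsto_of_complete h4
  have hjw : j w = h := by
    refine tendsto_nhds_unique ((j.continuous.tendsto w).comp hw) ?_
    convert hu using 1
    exact funext hv
  refine ⟨⟨w, hjw⟩, ?_⟩
  have h5 : ∀ n, (ofModel j hj (1 + Complex.I • C)).val (u n - ⟨h, w, hjw⟩) (u n - ⟨h, w, hjw⟩) =
      inner ℂ (v n - w) ((1 + Complex.I • C) (v n - w)) - inner ℂ (j (v n - w)) (j (v n - w)) := by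
    intro n
    have h6 : j (v n - w) =
        (u n - ⟨h, w, hjw⟩ : (ofModel j hj (1 + Complex.I • C)).dom) := by
      rw [map_sub, hv, hjw]
      rfl
    rw [ofModel_val h6 h6, ← h6]
  simp only [h5]
  have h6 : Continuous fun x : V =>
      inner ℂ x ((1 + Complex.I • C) x) - inner ℂ (j x) (j x) := by fun_prop
  have h7 : Tendsto (fun n => v n - w) atTop (𝓝 0) := by simpa using hw.sub_const w
  have h8 := (h6.tendsto 0).comp h7
  rwa [map_zero, map_zero, inner_zero_left, inner_zero_left, sub_zero] at h8

variable [CompleteSpace E]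

theorem ofModel_represents_one {C : V →L[ℂ] V} (hC : IsSelfAdjoint C) :
    (ofModel j hj (1 + Complex.I • C)).realPart.Represents (LinRel.formRel j 1) := by
  rintro p ⟨v, hv, hv'⟩
  refine ⟨⟨v, hv⟩, fun k => ?_⟩
  obtain ⟨w, hw⟩ := ofModel_dom_exists k
  have hv'' : v = adjoint j (p.1 + p.2) := hv'
  have h1 := ofModel_realPart_val (hj := hj) hC (h := ⟨p.1, v, hv⟩) hv hw
  refine h1.trans ?_
  have h2 : inner ℂ w v = inner ℂ (k : E) (p.1 + p.2) := by
    rw [hv'', adjoint_inner_right, hw]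
  rw [h2, inner_add_right]
  exact add_sub_cancel_left _ _

end Model

/-! ### From relations and closed forms to Hilbert spaces -/

section Construction

variable {E : Type u} [NormedAddCommGroup E] [InnerProductSpace ℂ E] [CompleteSpace E]

/-- The closed sectorial form of a sectorial relation, the relation of its real part, and the square
root of the operator part of the latter exist. -/
theorem exists_form {H : Submodule ℂ (E × E)} (hH : LinRel.IsSectorial H) :
    ∃ (t : SesqForm E) (A S : Submodule ℂ (E × E)), t.IsFormOf H ∧ t.IsRealPartRel A ∧
      LinRel.IsSqrtIn (LinRel.mul A)ᗮ S (LinRel.opPart A) := by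
  obtain ⟨α, h0, hα, hs⟩ := hH
  -- The form lives on the graph H, not on dom H; completing it also divides out its null vectors.
  let b : H →ₗ⋆[ℂ] H →ₗ[ℂ] ℂ := LinearMap.mk₂'ₛₗ (starRingEnd ℂ) (RingHom.id ℂ)
    (fun x y => inner ℂ x.1.1 y.1.2) (by intros; simp)
    (by intros; simp [mul_comm]) (by intros; simp) (by intros; simp)
  have hτ : 0 ≤ Real.tan α := Real.tan_nonneg_of_nonneg_of_le_pi_div_two h0 hα.le
  obtain ⟨V, _, _, _, e, j, C, he, hje, hC, hle, hbd, -, hb⟩ :=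
    exists_sectorial_model (LinearMap.fst ℂ E E ∘ₗ H.subtype) b hτ (fun x => hs x x.2)
  have hT : ∀ (v : V) (p : H), inner ℂ v ((1 + Complex.I • C) (e p)) =
      inner ℂ (j v) (p.1.1 + p.1.2) := by
    intro v p
    refine he.induction_on (p := fun v => inner ℂ v ((1 + Complex.I • C) (e p)) =
      inner ℂ (j v) (p.1.1 + p.1.2)) v (isClosed_eq (by fun_prop) (by fun_prop)) fun q => ?_
    have h1 : inner ℂ q.1.1 p.1.2 =
      inner ℂ (e q) ((1 + Complex.I • C) (e p)) - inner ℂ q.1.1 p.1.1 := hb q p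
    rw [hje, inner_add_right]
    change _ = inner ℂ q.1.1 p.1.1 + inner ℂ q.1.1 p.1.2
    rw [h1]
    ring
  -- Closability: if jv = 0 then v is orthogonal to (1 + iC)e(p) for all p, hence by density to (1 +
  -- iC)v, whose pairing with v has real part ‖v‖².
  have hj : Function.Injective j := by
    rw [injective_iff_map_eq_zero]
    intro v hv
    have h1 : inner ℂ v ((1 + Complex.I • C) v) = 0 := by
      refine he.induction_on (p := fun w => inner ℂ v ((1 + Complex.I • C) w) = 0) v
        (isClosed_eq (by fun_prop) (by fun_prop)) fun p => ?_
      rw [hT, hv, inner_zero_left]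
    have h2 : (inner ℂ v (C v)).im = 0 :=
      (ContinuousLinearMap.isSelfAdjoint_iff_isSymmetric.mp hC).im_inner_self_apply v
    have h3 : (inner ℂ v v).re = ‖v‖ ^ 2 := inner_self_eq_norm_sq (𝕜 := ℂ) v
    have h4 := congrArg Complex.re h1
    simp only [add_apply, one_apply_eq_self, smul_apply, inner_add_right, inner_smul_right,
      Complex.add_re, h3, Complex.mul_re, h2, Complex.I_re, Complex.zero_re] at h4
    simpa using h4
  obtain ⟨S, hS⟩ := LinRel.exists_isSqrtIn hj hle
  refine ⟨ofModel j hj (1 + Complex.I • C), LinRel.formRel j 1, S,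
    ⟨ofModel_isSectorial hC h0 hα hle hbd, ofModel_isClosed hC, fun p hp => ?_⟩,
    ⟨LinRel.formRel_one_isNonnegSelfAdjointIn hle, ofModel_represents_one hC⟩, hS⟩
  have h1 : j (e ⟨p, hp⟩) = p.1 := hje ⟨p, hp⟩
  refine ⟨⟨_, h1⟩, fun k => ?_⟩
  obtain ⟨w, hw⟩ := ofModel_dom_exists k
  have h2 := ofModel_val (hj := hj) (T := 1 + Complex.I • C) (h := ⟨p.1, _, h1⟩) h1 hw
  refine h2.trans ?_
  rw [hT, hw, inner_add_right]
  ring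

/-- The Hilbert space of a closed sectorial form. -/
theorem exists_model_of_isClosed {t : SesqForm E} (hs : t.IsSectorial) (hc : t.IsClosed) :
    ∃ (V : Type u) (_ : NormedAddCommGroup V) (_ : InnerProductSpace ℂ V) (_ : CompleteSpace V)
      (e : t.dom →ₗ[ℂ] V) (j : V →L[ℂ] E) (C : V →L[ℂ] V) (β : ℝ), Function.Surjective e ∧
      (∀ x, j (e x) = x) ∧ Function.Injective j ∧ IsSelfAdjoint C ∧ (∀ v, ‖j v‖ ≤ ‖v‖) ∧
      0 ≤ β ∧ β < Real.pi / 2 ∧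
      (∀ v, |(inner ℂ v (C v)).re| ≤ Real.tan β * (‖v‖ ^ 2 - ‖j v‖ ^ 2)) ∧
      (∀ x y : t.dom, t.realPart.val x y = inner ℂ (e y) (e x) - inner ℂ (y : E) x) ∧
      ∀ x y, t.val x y = inner ℂ (e y) ((1 + Complex.I • C) (e x)) - inner ℂ (y : E) x := by
  obtain ⟨β, h0, hβ, hs⟩ := hs
  have hτ : 0 ≤ Real.tan β := Real.tan_nonneg_of_nonneg_of_le_pi_div_two h0 hβ.le
  obtain ⟨V, _, _, _, e, j, C, he, hje, hC, hle, hbd, hre, hb⟩ :=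
    exists_sectorial_model t.dom.subtype t.val.flip hτ (fun x => by
      have := hs x
      rwa [realPart_self_re, imagPart_self_re] at this)
  have hval : ∀ x y, t.val x y = inner ℂ (e y) ((1 + Complex.I • C) (e x)) - inner ℂ (y : E) x :=
    fun x y => hb y x
  have hreal : ∀ x y : t.dom,
      t.realPart.val x y = inner ℂ (e y) (e x) - inner ℂ (y : E) x :=
    fun x y => (sub_eq_iff_eq_add.2 (hre y x)).symm
  have hnorm : ∀ x, ‖e x‖ ^ 2 = (t.val x x).re + ‖(x : E)‖ ^ 2 := by
    intro x
    have h2 : (inner ℂ (e x) (e x)).re = ‖e x‖ ^ 2 := inner_self_eq_norm_sq (𝕜 := ℂ) _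
    have h3 : (inner ℂ (x : E) x).re = ‖(x : E)‖ ^ 2 := inner_self_eq_norm_sq (𝕜 := ℂ) _
    have h4 := (realPart_self_re t x).symm.trans (congrArg Complex.re (hreal x x))
    rw [h4, Complex.sub_re, h2, h3]
    ring
  -- Closedness of t says exactly that the completion adds no new vectors.
  have hsurj : Function.Surjective e := by
    intro v
    obtain ⟨x, hx, hxv⟩ := mem_closure_iff_seq_limit.1 (he v)
    choose u hu using hx
    obtain rfl : (fun n => e (u n)) = x := funext hu
    have hju : Tendsto (fun n => (u n : E)) atTop (𝓝 (j v)) := by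
      have := (j.continuous.tendsto v).comp hxv
      simp only [Function.comp_def, hje] at this
      exact this
    have h6 : Continuous fun x : V =>
      inner ℂ x ((1 + Complex.I • C) x) - inner ℂ (j x) (j x) := by fun_prop
    have h7 : Tendsto (fun q : ℕ × ℕ => e (u q.1) - e (u q.2)) atTop (𝓝 0) := by
      rw [tendsto_zero_iff_norm_tendsto_zero]
      simpa only [dist_eq_norm] using cauchySeq_iff_tendsto_dist_atTop_0.1 hxv.cauchySeq
    obtain ⟨hd, hlim⟩ := hc u (j v) hju (by
      have := (h6.tendsto 0).comp h7
      simp only [map_zero, inner_zero_left, sub_zero] at this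
      refine this.congr fun q => ?_
      rw [hval, Function.comp_apply, ← map_sub, hje]
      rfl)
    refine ⟨⟨j v, hd⟩, (tendsto_nhds_unique hxv ?_).symm⟩
    rw [tendsto_iff_norm_sub_tendsto_zero]
    have h8 : Tendsto (fun n => ‖e (u n) - e ⟨j v, hd⟩‖ ^ 2) atTop (𝓝 0) := by
      simp only [← map_sub, hnorm]
      simpa using ((Complex.continuous_re.tendsto 0).comp hlim).add
        ((hju.sub_const (j v)).norm.pow 2)
    exact tendsto_norm_zero_of_sq h8
  refine ⟨V, _, _, _, e, j, C, β, hsurj, hje, ?_, hC, hle, h0, hβ, hbd, hreal, hval⟩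
  rw [injective_iff_map_eq_zero]
  intro v hv
  obtain ⟨x, rfl⟩ := hsurj v
  have : x = 0 := Subtype.ext ((hje x).symm.trans hv)
  rw [this, map_zero]

end Construction

end SesqForm

/-! ### The operator G and the factorization -/

namespace LinRel

open ContinuousLinearMap (adjoint adjoint_inner_left adjoint_inner_right)

section Representation

variable {V E : Type*} [NormedAddCommGroup V] [InnerProductSpace ℂ V] [CompleteSpace V]
  [NormedAddCommGroup E] [InnerProductSpace ℂ E] [CompleteSpace E]

theorem IsSqrtIn.inner_eq {j : V →L[ℂ] E} (hj : Function.Injective j) {S : Submodule ℂ (E × E)}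
    (hS : IsSqrtIn (mul (formRel j 1))ᗮ S (opPart (formRel j 1))) {v w : V} {s u : E}
    (hs : (j v, s) ∈ S) (hu : (j w, u) ∈ S) :
    inner ℂ u s = inner ℂ w v - inner ℂ (j w) (j v) := by
  obtain ⟨u', hu', h⟩ := hS.exists_mem hj w
  rw [hS.unique hu hu', h v s hs]

/-- The imaginary part `C` of the form, transported along the square root `S`. -/
theorem IsSqrtIn.exists_operator {j : V →L[ℂ] E} (hj : Function.Injective j)
    (hle : ∀ v, ‖j v‖ ≤ ‖v‖) {S : Submodule ℂ (E × E)}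
    (hS : IsSqrtIn (mul (formRel j 1))ᗮ S (opPart (formRel j 1))) {C : V →L[ℂ] V}
    (hC : IsSelfAdjoint C) {M : ℝ} (hM : 0 ≤ M)
    (hbd : ∀ v, |(inner ℂ v (C v)).re| ≤ M * (‖v‖ ^ 2 - ‖j v‖ ^ 2)) :
    ∃ G : E →L[ℂ] E, IsSelfAdjoint G ∧ ‖G‖ ≤ M ∧
      (∀ v w s u, (j v, s) ∈ S → (j w, u) ∈ S → inner ℂ u (G s) = inner ℂ w (C v)) ∧
      ∀ z, (∀ p ∈ S, inner ℂ p.2 z = 0) → G z = 0 := by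
  -- The form of C is pulled back to the graph of S, where the second component σ has range ran S
  -- and ‖σ p‖² = ‖a p‖² − ‖j (a p)‖².
  choose a ha using fun p : S => hS.exists_of_mem hj hle p.2
  let a' : S →ₗ[ℂ] V :=
    { toFun := a
      map_add' := fun p q => hj (by simp [ha])
      map_smul' := fun c p => hj (by simp [ha]) }
  let b : S →ₗ⋆[ℂ] S →ₗ[ℂ] ℂ := LinearMap.mk₂'ₛₗ (starRingEnd ℂ) (RingHom.id ℂ)
    (fun p q => inner ℂ (a' p) (C (a' q))) (by intros; simp)
    (by intros; simp [mul_comm]) (by intros; simp) (by intros; simp)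
  have hb : ∀ p q, conj (b p q) = b q p := by
    intro p q
    change conj (inner ℂ (a p) (C (a q))) = inner ℂ (a q) (C (a p))
    rw [inner_conj_symm]
    exact ContinuousLinearMap.isSelfAdjoint_iff_isSymmetric.mp hC _ _
  have hmem : ∀ p : S, (j (a p), p.1.2) ∈ S := fun p => by rw [ha]; exact p.2
  let σ : S →ₗ[ℂ] E := LinearMap.snd ℂ E E ∘ₗ S.subtype
  obtain ⟨G, hG, hGM, hGb, hG0⟩ := exists_selfAdjoint_vanishing σ b hb hM
    (norm_hermitian_le_of_diag b hb σ fun p => by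
      have h1 := congrArg Complex.re (hS.inner_eq hj (hmem p) (hmem p))
      have h2 : (inner ℂ p.1.2 p.1.2).re = ‖p.1.2‖ ^ 2 := inner_self_eq_norm_sq (𝕜 := ℂ) _
      have h3 : (inner ℂ (a p) (a p)).re = ‖a p‖ ^ 2 := inner_self_eq_norm_sq (𝕜 := ℂ) _
      have h4 : (inner ℂ (j (a p)) (j (a p))).re = ‖j (a p)‖ ^ 2 :=
        inner_self_eq_norm_sq (𝕜 := ℂ) _
      rw [Complex.sub_re, h2, h3, h4] at h1
      change |(inner ℂ (a p) (C (a p))).re| ≤ M * ‖p.1.2‖ ^ 2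
      rw [h1]
      exact hbd _)
  refine ⟨G, hG, hGM, fun v w s u hs hu => ?_, fun z hz => hG0 z fun p => hz p p.2⟩
  have h1 : inner ℂ u (G s) = inner ℂ (a ⟨_, hu⟩) (C (a ⟨_, hs⟩)) := hGb ⟨_, hu⟩ ⟨_, hs⟩
  rw [h1, hj (ha ⟨_, hu⟩), hj (ha ⟨_, hs⟩)]

/-- Both memberships express the same weak equation ((1 + iG)Sh, Sk) = (h', k) for all k ∈ dom S =
jV. The condition on the range of G keeps (1 + iG)Sh in the space where S^× is defined. -/
theorem formRel_eq_comp {j : V →L[ℂ] E} (hj : Function.Injective j)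
    (hle : ∀ v, ‖j v‖ ≤ ‖v‖) {S : Submodule ℂ (E × E)}
    (hS : IsSqrtIn (mul (formRel j 1))ᗮ S (opPart (formRel j 1))) {C : V →L[ℂ] V}
    {G : E →L[ℂ] E} (hGK : ∀ x, G x ∈ (mul (formRel j 1))ᗮ)
    (hG : ∀ v w s u, (j v, s) ∈ S → (j w, u) ∈ S → inner ℂ u (G s) = inner ℂ w (C v)) :
    formRel j (1 + Complex.I • C) = comp (comp (adjointIn ⊤ (mul (formRel j 1))ᗮ S)
      (LinearMap.graph ((ContinuousLinearMap.id ℂ E + Complex.I • G : E →L[ℂ] E) : E →ₗ[ℂ] E)))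
      S := by
  have key : ∀ {v w s u}, (j v, s) ∈ S → (j w, u) ∈ S → inner ℂ u (s + Complex.I • G s) =
      inner ℂ w ((1 + Complex.I • C) v) - inner ℂ (j w) (j v) := by
    intro v w s u hs hu
    rw [inner_add_right, inner_smul_right, hG v w s u hs hu, hS.inner_eq hj hs hu]
    simp only [add_apply, one_apply_eq_self, smul_apply, inner_add_right, inner_smul_right]
    ring
  ext ⟨h, h'⟩
  constructor
  · rintro ⟨v, rfl : j v = h, hv⟩
    obtain ⟨s, hs, -⟩ := hS.exists_mem hj v
    refine ⟨s, hs, s + Complex.I • G s, rfl, ?_, ?_, trivial⟩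
    · rw [SetLike.mem_coe, Submodule.mem_adjoint_iff]
      intro x u hu
      obtain ⟨w, rfl : j w = x⟩ := hS.exists_of_mem hj hle hu
      simp only
      rw [key hs hu, hv, adjoint_inner_right, inner_add_right]
      ring
    · exact Submodule.add_mem _ (hS.1.mem hs).2 (Submodule.smul_mem _ _ (hGK _))
  · rintro ⟨s, hs, ψ, hψ, hadj, -⟩
    obtain rfl : ψ = s + Complex.I • G s := hψ
    obtain ⟨v, rfl : j v = h⟩ := hS.exists_of_mem hj hle hs
    rw [SetLike.mem_coe, Submodule.mem_adjoint_iff] at hadj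
    refine ⟨v, rfl, ext_inner_left ℂ fun w => ?_⟩
    obtain ⟨u, hu, -⟩ := hS.exists_mem hj w
    have h1 := hadj _ _ hu
    simp only at h1
    rw [key hs hu] at h1
    rw [adjoint_inner_right, inner_add_right]
    linear_combination h1

end Representation

end LinRel

end

/-! ### The second representation theorem -/

theorem theorem5p2 {E : Type*} [NormedAddCommGroup E] [InnerProductSpace ℂ E] [CompleteSpace E]
    (H : Submodule ℂ (E × E)) (hH : LinRel.IsMaximalSectorial H) :
    -- the form `t` of `H`, the real part `A` of `H` and the square root `S` of the operator part
    -- of `A`, taken in the Hilbert space `(mul A)ᗮ`, exist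
    (∃ (t : SesqForm E) (A S : Submodule ℂ (E × E)),
      t.IsFormOf H ∧ t.IsRealPartRel A ∧
        LinRel.IsSqrtIn (LinRel.mul A)ᗮ S (LinRel.opPart A)) ∧
    ∀ (t : SesqForm E) (A S : Submodule ℂ (E × E)),
      t.IsFormOf H → t.IsRealPartRel A →
      LinRel.IsSqrtIn (LinRel.mul A)ᗮ S (LinRel.opPart A) →
      ∃ G : E →L[ℂ] E,
        IsSelfAdjoint G ∧
        ‖G‖ = Real.tan (LinRel.semiAngle H) ∧
        (∀ x ∈ LinRel.ker A ⊔ LinRel.mul A, G x = 0) ∧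
        t.dom = LinRel.dom S ∧
        (∀ (h k : t.dom) (φ ψ : E), ((h : E), φ) ∈ S → ((k : E), ψ) ∈ S →
          t.val h k = inner ℂ ψ (φ + Complex.I • G φ)) ∧
        H = LinRel.comp
          (LinRel.comp (LinRel.adjointIn ⊤ (LinRel.mul A)ᗮ S)
            (LinearMap.graph ((ContinuousLinearMap.id ℂ E + Complex.I • G : E →L[ℂ] E) : E →ₗ[ℂ] E)))
          S ∧
        LinRel.mul H = LinRel.mul A := by
  refine ⟨SesqForm.exists_form hH.1, ?_⟩
  rintro t A S ⟨hts, htc, htH⟩ ⟨hA, htA⟩ hS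
  obtain ⟨V, _, _, _, e, j, C, β, he, hje, hj, hC, hle, h0, hβ, hbd, hre, hval⟩ :=
    SesqForm.exists_model_of_isClosed hts htc
  have hHeq : LinRel.formRel j (1 + Complex.I • C) = H := by
    -- Maximality enters here: the relation of t is a sectorial extension of H, with an angle β of t
    -- that need not be the semi-angle.
    refine hH.2 _ ⟨β, LinRel.formRel_isSectorialWith hC h0 hβ hle hbd⟩ fun p hp => ?_
    obtain ⟨hd, hk⟩ := htH p hp
    refine ⟨e ⟨p.1, hd⟩, hje _, ext_inner_left ℂ fun w => ?_⟩
    obtain ⟨k, rfl⟩ := he w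
    have h1 := hk k
    rw [hval] at h1
    rw [ContinuousLinearMap.adjoint_inner_right, hje, inner_add_right, ← h1]
    ring
  obtain rfl : A = LinRel.formRel j 1 := by
    refine LinRel.eq_formRel_one_of_le hA fun p hp => ?_
    obtain ⟨hd, hk⟩ := htA p hp
    refine ⟨e ⟨p.1, hd⟩, hje ⟨p.1, hd⟩, ext_inner_left ℂ fun w => ?_⟩
    obtain ⟨k, rfl⟩ := he w
    have h1 := (hre ⟨p.1, hd⟩ k).symm.trans (hk k)
    rw [ContinuousLinearMap.adjoint_inner_right, hje, inner_add_right, ← h1]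
    exact (add_sub_cancel _ _).symm
  subst hHeq
  have hα := (LinRel.isLeast_semiAngle hH.1).1
  set α := LinRel.semiAngle (LinRel.formRel j (1 + Complex.I • C))
  have htan : 0 ≤ Real.tan α := Real.tan_nonneg_of_nonneg_of_le_pi_div_two hα.1 hα.2.1.le
  obtain ⟨G, hG, hGM, hGC, hG0⟩ :=
    hS.exists_operator hj hle hC htan (LinRel.IsSectorialWith.formRel_bound hj hC hα)
  have hGmul : ∀ m ∈ LinRel.mul (LinRel.formRel j 1), G m = 0 := fun m hm =>
    hG0 m fun p hp => Submodule.inner_left_of_mem_orthogonal hm (hS.1.mem hp).2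
  have hGK : ∀ x, G x ∈ (LinRel.mul (LinRel.formRel j 1))ᗮ := fun x m hm => by
    have h1 : inner ℂ (G m) x = inner ℂ m (G x) :=
      ContinuousLinearMap.isSelfAdjoint_iff_isSymmetric.mp hG m x
    rw [← h1, hGmul m hm, inner_zero_left]
  have hSdiag : ∀ v s, (j v, s) ∈ S → ‖s‖ ^ 2 = ‖v‖ ^ 2 - ‖j v‖ ^ 2 := by
    intro v s hs
    have h1 := congrArg Complex.re (hS.inner_eq hj hs hs)
    have h2 : (inner ℂ s s).re = ‖s‖ ^ 2 := inner_self_eq_norm_sq (𝕜 := ℂ) _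
    have h3 : (inner ℂ v v).re = ‖v‖ ^ 2 := inner_self_eq_norm_sq (𝕜 := ℂ) _
    have h4 : (inner ℂ (j v) (j v)).re = ‖j v‖ ^ 2 := inner_self_eq_norm_sq (𝕜 := ℂ) _
    rwa [Complex.sub_re, h2, h3, h4] at h1
  refine ⟨G, hG, le_antisymm hGM ?_, ?_, ?_, ?_, LinRel.formRel_eq_comp hj hle hS hGK hGC, ?_⟩
  -- Since |(Cv, v)| = |(GSjv, Sjv)| ≤ ‖G‖ ‖Sjv‖², the angle arctan ‖G‖ is admissible, and
  -- minimality of α gives tan α ≤ ‖G‖.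
  · have h1 : LinRel.IsSectorialWith (LinRel.formRel j (1 + Complex.I • C))
        (Real.arctan ‖G‖) := by
      refine LinRel.formRel_isSectorialWith hC (Real.arctan_nonneg.2 (norm_nonneg _))
        (Real.arctan_lt_pi_div_two _) hle fun v => ?_
      obtain ⟨s, hs, -⟩ := hS.exists_mem hj v
      rw [Real.tan_arctan, ← hSdiag v s hs, ← hGC v v s s hs hs]
      calc _ ≤ ‖inner ℂ s (G s)‖ := Complex.abs_re_le_norm _
        _ ≤ ‖s‖ * ‖G s‖ := norm_inner_le_norm _ _
        _ ≤ ‖s‖ * (‖G‖ * ‖s‖) := by gcongr; exact G.le_opNorm s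
        _ = _ := by ring
    have h2 := (LinRel.isLeast_semiAngle hH.1).2 h1
    rw [← Real.tan_arctan ‖G‖]
    exact Real.strictMonoOn_tan.monotoneOn ⟨by linarith [hα.1, Real.pi_pos], hα.2.1⟩
      ⟨Real.neg_pi_div_two_lt_arctan _, Real.arctan_lt_pi_div_two _⟩ h2
  · intro x hx
    obtain ⟨y, hy, m, hm, rfl⟩ := Submodule.mem_sup.1 hx
    rw [map_add, hGmul m hm, add_zero]
    obtain ⟨v, rfl : j v = y, hv⟩ : ((y : E), (0 : E)) ∈ LinRel.formRel j 1 := hy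
    obtain ⟨s, hs, -⟩ := hS.exists_mem hj v
    -- On ker H_r one has v = j†jv, so ‖Sjv‖² = ‖v‖² − ‖jv‖² = 0; symmetry of S then makes jv
    -- orthogonal to ran S, where G vanishes.
    have h1 : inner ℂ v v = inner ℂ (j v) (j v) := by
      have hv' : v = ContinuousLinearMap.adjoint j (j v) := by simpa using hv
      rw [← ContinuousLinearMap.adjoint_inner_right, ← hv']
    have h2 : s = 0 := by
      rw [← inner_self_eq_zero (𝕜 := ℂ), hS.inner_eq hj hs hs, h1, sub_self]
    subst h2
    refine hG0 _ fun p hp => ?_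
    rw [hS.1.inner_symm hs hp, inner_zero_right]
  · ext x
    constructor
    · intro hx
      obtain ⟨s, hs, -⟩ := hS.exists_mem hj (e ⟨x, hx⟩)
      rw [hje] at hs
      exact ⟨_, hs, rfl⟩
    · rintro ⟨p, hp, rfl⟩
      obtain ⟨v, hv⟩ := hS.exists_of_mem hj hle hp
      obtain ⟨k, rfl⟩ := he v
      rw [hje] at hv
      change p.1 ∈ t.dom
      rw [← hv]
      exact k.2
  · intro h k φ ψ hφ hψ
    rw [← hje] at hφ hψ
    rw [hval, inner_add_right, inner_smul_right, hGC _ _ _ _ hφ hψ, hS.inner_eq hj hφ hψ, hje, hje]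
    simp only [add_apply, one_apply_eq_self, smul_apply, inner_add_right, inner_smul_right]
    ring
  · ext x
    rw [LinRel.mem_mul_formRel hj, LinRel.mem_mul_formRel hj]
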